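/- Let $r\ge 1$, $n\ge 0$ and $d\ge1$ with $d\mid r$, and put $p=r/d$, $\xi=e^{2\pi i/r}$, $C_m=\{z\in\mathbb C: z^m=1\}$. Let $G(r,1,n)=C_r^n\rtimes S_n$, where $\sigma(\xi_1,\dots,\xi_n)=(\xi_{\sigma^{-1}(1)},\dots,\xi_{\sigma^{-1}(n)})$, let $G(r,d,n)$ be the kernel of $(\xi_1,\dots,\xi_n,\sigma)\mapsto(\xi_1\cdots\xi_n)^p$, and let $S_n$ be the subgroup $\{(1,\dots,1,\sigma)\}$ of both. A pair $(G,H)$ of a finite group and a subgroup is a Gelfand pair if $\mathrm{Ind}_H^G(1_H)$ is multiplicity-free; its zonal spherical functions are the functions $\omega(g)=\langle v\mid gv\rangle$, where $V$ runs over the irreducible constituents of $\mathrm{Ind}_H^G(1_H)$, $\langle\cdot\mid\cdot\rangle$ is a $G$-invariant inner product on $V$ (linear in the first argument), and $v\in V$ is an $H$-invariant unit vector. Let $X_n^{r-1}=\{(k_0,\dots,k_{r-1})\in\mathbb N^r:\sum_i k_i=n\}$, on which the symmetric group of $\{0,\dots,r-1\}$ acts by $\sigma(k_0,\dots,k_{r-1})=(k_{\sigma^{-1}(0)},\dots,k_{\sigma^{-1}(r-1)})$,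 and let $\Gamma=\langle(0\;1\;\cdots\;r-1)^p\rangle$. For $k\in X_n^{r-1}$ let $V^k$ be the span of the monomials $x_1^{a_1}\cdots x_n^{a_n}$ in which each $j\in\{0,\dots,r-1\}$ occurs exactly $k_j$ times among $a_1,\dots,a_n$; here $(\xi_1,\dots,\xi_n,\sigma)\in G(r,1,n)$ acts on polynomials by $f(x_1,\dots,x_n)\mapsto f(\xi_{\sigma(1)}^{-1}x_{\sigma(1)},\dots,\xi_{\sigma(n)}^{-1}x_{\sigma(n)})$. For $g=(\xi_1,\dots,\xi_n,\sigma)\in G(r,1,n)$ let $l_j=|\{i:\xi_i=\xi^j\}|$ and put $$\omega^k(g)=\sum_{(a_{ij})}\frac{\prod_{i=1}^{r-1}(-l_i)_{\sum_j a_{ij}}\ \prod_{j=1}^{r-1}(-k_j)_{\sum_i a_{ij}}}{(-n)_{\sum_{i,j}a_{ij}}}\cdot\frac{\prod_{i,j}(1-\xi^{ij})^{a_{ij}}}{\prod_{i,j}a_{ij}!},$$ where the sum is over all $(r-1)\times(r-1)$ matrices $(a_{ij})_{1\le i,j\le r-1}$ of natural numbers with $\sum_{i,j} a_{ij}\le n$,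 and $(x)_m=x(x+1)\cdots(x+m-1)$. Then $(G(r,1,n),S_n)$ and $(G(r,d,n),S_n)$ are Gelfand pairs; $\Gamma\cong C_d$; for every $k\in X_n^{r-1}$ the function $\omega^k$ is the zonal spherical function of $(G(r,1,n),S_n)$ belonging to $V^k$ (which is irreducible and is a constituent of the representation induced from the trivial representation of $S_n$); and $\Gamma k\mapsto\omega^k|_{G(r,d,n)}$ is a well-defined bijection from the set of orbits $X_n^{r-1}/\Gamma$ onto the set of zonal spherical functions of $(G(r,d,n),S_n)$. -/

import Mathlib

noncomputable section

namespace SphericalCRG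

/-! ## Finite Gelfand pairs and zonal spherical functions -/

section Gelfand

variable {G : Type} [Group G]

/-- The representation of `G` induced from the trivial representation of `H`. -/
abbrev indOne (H : Subgroup G) :
    Representation ℂ G
      (Representation.IndV H.subtype (Representation.trivial ℂ H ℂ)) :=
  Representation.ind H.subtype (Representation.trivial ℂ H ℂ)

/-- `(G, H)` is a Gelfand pair: the induced representation of the trivial representation is
multiplicity-free, i.e. distinct irreducible subrepresentations are never isomorphic. -/
def IsGelfandPair (H : Subgroup G) : Prop :=
  ∀ U W : Subrepresentation (indOne H),
    U.toRepresentation.IsIrreducible → W.toRepresentation.IsIrreducible →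
      Nonempty (U.toRepresentation.Equiv W.toRepresentation) → U = W

/-- `ω` is the function `g ↦ ⟨v | g v⟩` for a `G`-invariant inner product on the representation
and an `H`-invariant unit vector `v`. The form `⟨v | w⟩` is linear in its first argument, while
`InnerProductSpace.Core.inner` is conjugate linear in its first argument, so that
`⟨v | g v⟩ = inner (g v) v`. -/
def IsSphericalCoefficient (H : Subgroup G) {V : Type} [AddCommGroup V] [Module ℂ V]
    (ρ : Representation ℂ G V) (ω : G → ℂ) : Prop :=
  ∃ B : InnerProductSpace.Core ℂ V,
    (∀ (g : G) (v w : V), B.inner (ρ g v) (ρ g w) = B.inner v w) ∧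
    ∃ v : V, (∀ h ∈ H, ρ h v = v) ∧ B.inner v v = 1 ∧ ∀ g : G, ω g = B.inner (ρ g v) v

/-- `ω` is the zonal spherical function of `(G, H)` belonging to the representation `ρ`, which is
required to be irreducible and to occur in the induced representation of the trivial one. -/
def IsZonalSphericalOf (H : Subgroup G) {V : Type} [AddCommGroup V] [Module ℂ V]
    (ρ : Representation ℂ G V) (ω : G → ℂ) : Prop :=
  ρ.IsIrreducible ∧
    (∃ U : Subrepresentation (indOne H), Nonempty (ρ.Equiv U.toRepresentation)) ∧
    IsSphericalCoefficient H ρ ω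

/-- `ω` is one of the zonal spherical functions of `(G, H)`. -/
def IsZonalSpherical (H : Subgroup G) (ω : G → ℂ) : Prop :=
  ∃ U : Subrepresentation (indOne H),
    U.toRepresentation.IsIrreducible ∧ IsSphericalCoefficient H U.toRepresentation ω

end Gelfand

/-! ## The complex reflection groups -/

/-- `ξ = exp (2 π i / r)`. -/
def xi (r : ℕ) : ℂ := Complex.exp (2 * Real.pi * Complex.I / r)

/-- `G(r,1,n) = C_r^n ⋊ S_n`, where `σ (ξ₁, …, ξₙ) = (ξ_{σ⁻¹(1)}, …, ξ_{σ⁻¹(n)})`. -/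
abbrev GR (r n : ℕ) : Type :=
  (Fin n → rootsOfUnity r ℂ) ⋊[mulAutArrow] Equiv.Perm (Fin n)

/-- The homomorphism `(ξ₁, …, ξₙ, σ) ↦ (ξ₁ ⋯ ξₙ) ^ (r / d)`. -/
def Phi (r d n : ℕ) : GR r n →* ℂˣ where
  toFun g := (∏ i, (g.left i : ℂˣ)) ^ (r / d)
  map_one' := by simp
  map_mul' g h := by
    have : ∏ i, ((h.left (g.right⁻¹ i) : rootsOfUnity r ℂ) : ℂˣ) = ∏ i, (h.left i : ℂˣ) :=
      Equiv.prod_comp g.right⁻¹ (fun i => (h.left i : ℂˣ))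
    rw [← mul_pow]
    congr 1
    rw [← this, ← Finset.prod_mul_distrib]
    rfl

/-- `G(r,d,n)`. -/
def GRD (r d n : ℕ) : Subgroup (GR r n) := (Phi r d n).ker

/-- The copy `{(1, …, 1, σ)}` of `S_n` in `G(r,1,n)`. -/
def Sn (r n : ℕ) : Subgroup (GR r n) := 
  (SemidirectProduct.inr : Equiv.Perm (Fin n) →* GR r n).range

theorem Sn_le_GRD (r d n : ℕ) : Sn r n ≤ GRD r d n := by
  rintro _ ⟨σ, rfl⟩
  simp [GRD, MonoidHom.mem_ker, Phi]

/-- The copy of `S_n` as a subgroup of `G(r,d,n)`. -/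
def SnD (r d n : ℕ) : Subgroup (GRD r d n) := (Sn r n).subgroupOf (GRD r d n)

/-! ## The index set and the cyclic group `Γ` -/

/-- The tuples `(k₀, …, k_{r-1})` of natural numbers with sum `n`. -/
def Comp (r n : ℕ) : Type := {k : Fin r → ℕ // ∑ i, k i = n}

/-- `σ (k₀, …, k_{r-1}) = (k_{σ⁻¹(0)}, …, k_{σ⁻¹(r-1)})`. -/
instance (r n : ℕ) : MulAction (Equiv.Perm (Fin r)) (Comp r n) where
  smul σ k := ⟨fun i => k.1 (σ⁻¹ i), (Equiv.sum_comp σ⁻¹ k.1).trans k.2⟩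
  one_smul _ := rfl
  mul_smul _ _ _ := rfl

/-- `Γ = ⟨(0 1 … r-1) ^ (r / d)⟩`, a subgroup of `S_r`. -/
def Gam (r d : ℕ) : Subgroup (Equiv.Perm (Fin r)) :=
  Subgroup.zpowers (finRotate r ^ (r / d))

/-! ## The representations `V^k` of `G(r,1,n)` -/

/-- The action of `g = (ξ₁, …, ξₙ, σ)` on polynomials by the substitution
`xᵢ ↦ ξ_{σ(i)}⁻¹ x_{σ(i)}`, as an algebra homomorphism. -/
def polyAct {r n : ℕ} (g : GR r n) : MvPolynomial (Fin n) ℂ →ₐ[ℂ] MvPolynomial (Fin n) ℂ :=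
  MvPolynomial.aeval fun i =>
    MvPolynomial.C ((((g.left (g.right i) : ℂˣ)⁻¹ : ℂˣ) : ℂ)) * MvPolynomial.X (g.right i)

/-- The representation of `G(r,1,n)` on polynomials in `n` variables. -/
def polyRep (r n : ℕ) : Representation ℂ (GR r n) (MvPolynomial (Fin n) ℂ) where
  toFun g := (polyAct g).toLinearMap
  map_one' := by
    have : polyAct (1 : GR r n) = AlgHom.id ℂ _ := by
      ext i : 1
      simp [polyAct]
    rw [this]; rfl
  map_mul' g h := by
    have : polyAct (g * h) = (polyAct g).comp (polyAct h) := by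
      ext i : 1
      have e : (g * h).left (g.right (h.right i)) =
          g.left (g.right (h.right i)) * h.left (h.right i) :=
        congrArg (g.left (g.right (h.right i)) * h.left ·) (g.right.symm_apply_apply (h.right i))
      simp only [polyAct, MvPolynomial.aeval_X, AlgHom.comp_apply, SemidirectProduct.mul_right,
        Equiv.Perm.mul_apply, map_mul, MvPolynomial.algHom_C, MvPolynomial.algebraMap_eq, e,
        Subgroup.coe_mul, mul_inv, Units.val_mul]
      ring
    rw [this]; rfl

/-- The monomials `x₁^{a₁} ⋯ xₙ^{aₙ}` whose exponents lie in `{0, …, r-1}` and take each value `j`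
exactly `k_j` times; equivalently the monomials `x_{σ(1)}^{λ₁} ⋯ x_{σ(n)}^{λₙ}`, `σ ∈ S_n`, for
the sequence `λ` consisting of `k_j` copies of `j` for every `j`. -/
def monomialsOf {r n : ℕ} (k : Comp r n) : Set (MvPolynomial (Fin n) ℂ) :=
  {f | ∃ a : Fin n → Fin r, (∀ j, (Finset.univ.filter fun i => a i = j).card = k.1 j) ∧
    f = ∏ i, MvPolynomial.X i ^ (a i : ℕ)}

/-- `V^k`, the span of the monomials above. -/
def Vrep {r n : ℕ} (k : Comp r n) : Subrepresentation (polyRep r n) where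
  toSubmodule := Submodule.span ℂ (monomialsOf k)
  apply_mem_toSubmodule g v hv := by
    have : Submodule.span ℂ (monomialsOf k) ≤
        (Submodule.span ℂ (monomialsOf k)).comap (polyRep r n g) := by
      rw [Submodule.span_le]
      rintro _ ⟨a, ha, rfl⟩
      have key : polyRep r n g (∏ i, MvPolynomial.X i ^ (a i : ℕ)) =
          (∏ i, ((((g.left (g.right i) : ℂˣ)⁻¹ : ℂˣ) : ℂ)) ^ (a i : ℕ)) •
            ∏ i, MvPolynomial.X i ^ (a (g.right⁻¹ i) : ℕ) := by
        change polyAct g _ = _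
        rw [← Equiv.prod_comp g.right
          (fun i => (MvPolynomial.X i : MvPolynomial (Fin n) ℂ) ^ (a (g.right⁻¹ i) : ℕ))]
        simp only [polyAct, mul_pow, Finset.prod_mul_distrib, MvPolynomial.smul_eq_C_mul,
          map_prod, map_pow, MvPolynomial.aeval_X]
        congr 1
        refine Finset.prod_congr rfl fun i _ => ?_
        rw [show g.right⁻¹ (g.right i) = i from g.right.symm_apply_apply i]
      rw [SetLike.mem_coe, Submodule.mem_comap]
      rw [key]
      refine Submodule.smul_mem _ _ (Submodule.subset_span ⟨fun i => a (g.right⁻¹ i), ?_, rfl⟩)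
      intro j
      rw [← ha j]
      exact Finset.card_equiv g.right⁻¹ (by simp)
    exact this hv

/-! ## The hypergeometric functions -/

/-- The Aomoto-Gelfand hypergeometric function `F(α, β, -N, X)`: the sum over all matrices
`(a_{ij})` of natural numbers with `∑ a_{ij} ≤ N`. The Pochhammer symbol
`(x)_m = x (x + 1) ⋯ (x + m - 1)` is the value at `x` of `ascPochhammer ℂ m`. -/
def hyperF {ι κ : Type} [Fintype ι] [Fintype κ] [DecidableEq ι] [DecidableEq κ]
    (α : ι → ℂ) (β : κ → ℂ) (N : ℕ) (X : Matrix ι κ ℂ) : ℂ :=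
  ∑ a ∈ (Finset.univ : Finset (ι → κ → Fin (N + 1))).filter
      (fun a => ∑ i, ∑ j, (a i j : ℕ) ≤ N),
    ((∏ i, (ascPochhammer ℂ (∑ j, (a i j : ℕ))).eval (α i)) *
        (∏ j, (ascPochhammer ℂ (∑ i, (a i j : ℕ))).eval (β j)) /
        (ascPochhammer ℂ (∑ i, ∑ j, (a i j : ℕ))).eval (-(N : ℂ))) *
      ((∏ i, ∏ j, X i j ^ (a i j : ℕ)) / ∏ i, ∏ j, ((a i j : ℕ).factorial : ℂ))

/-- The index set `{1, …, r-1}`. -/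
abbrev PosIdx (r : ℕ) : Type := {i : Fin r // (i : ℕ) ≠ 0}

/-- The number `l_j` of indices `i` with `ξᵢ = ξ ^ j`, for `g = (ξ₁, …, ξₙ, σ)`. -/
def mult {r n : ℕ} (g : GR r n) (j : Fin r) : ℕ :=
  Nat.card {i : Fin n // ((g.left i : ℂˣ) : ℂ) = xi r ^ (j : ℕ)}

/-- The function
`g ↦ F((-l₁, …, -l_{r-1}), (-k₁, …, -k_{r-1}), -n, (1 - ξ^{ij})_{1 ≤ i, j ≤ r-1})`
on `G(r,1,n)`, where `l_j` is the number of occurrences of `ξ ^ j` in `g`. -/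
def omegaK {r n : ℕ} (k : Comp r n) (g : GR r n) : ℂ :=
  hyperF (fun i : PosIdx r => -(mult g i.1 : ℂ)) (fun j : PosIdx r => -(k.1 j.1 : ℂ)) n
    (Matrix.of fun i j : PosIdx r => 1 - xi r ^ ((i.1 : ℕ) * (j.1 : ℕ)))

end SphericalCRG

end

/-! Both groups factor as `A * S_n` with `A` an abelian diagonal subgroup: all of `C_r^n`, or the
subgroup `diagKer` of tuples whose product has trivial `r / d`-th power. This factorization gives
the Gelfand property. The induced representation is spanned by the `A`-translates of one `S_n`-fixed
vector, so every endomorphism commuting with the group is a combination of operators from `A` and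
preserves every subrepresentation (`mem_of_commute`). An isomorphism between two constituents
extends to such an endomorphism, so the constituents coincide (`isGelfandPair_of_commGroup`).

The second ingredient is an identity. Expanding the invariant unit vector of `V^k` in monomials
shows that its matrix coefficient at `g` is the average of the characters `chi a` at the diagonal
part of `g`, over all exponent sequences `a` of type `k` (`inner_unitVec`). This average satisfies
the same recursion in `n` as the hypergeometric sum: removing one letter of `g` lowers one `k_j`
(`sum_typeSet_mul_factorial`). Hence it equals `omegaK` (`omegaK_eq_typeAverage`). Irreducibility of
`V^k` follows by isolating single monomials with the distinct characters `chi a` and permuting them.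

For `G(r,d,n)`, the fixed vector of `V^k` generates an irreducible constituent after restriction, so
each restricted `omegaK k` is spherical (`exists_irreducible_of_fixed`). Conversely, any irreducible
constituent contains an eigenvector of `diagKer` whose character is the restriction of the inverse
of some `chi a`. Averaging over `S_n` expresses its spherical function as `omegaK` at the type of
`a` (`exists_inner_eq_omegaK`). Finally, `chi a` and `chi b` agree on `diagKer` exactly when `b` is
obtained from `a` by an element of `Γ` acting on the letters. Orthogonality of characters turns this
into the statement that restricted functions agree exactly along `Γ`-orbits (`omegaK_Gam_smul`,
`exists_Gam_smul_eq`). -/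

noncomputable section

namespace SphericalCRG

/-! ### Inner products given as bare cores. -/

section Core

variable {V : Type*} [AddCommGroup V] [Module ℂ V] (B : InnerProductSpace.Core ℂ V)

theorem core_inner_zero_left (w : V) : B.inner 0 w = 0 := by
  have := B.smul_left 0 w 0
  simpa using this

theorem core_inner_sum_left {ι : Type*} (s : Finset ι) (f : ι → V) (w : V) :
    B.inner (∑ i ∈ s, f i) w = ∑ i ∈ s, B.inner (f i) w := by
  classical
  induction s using Finset.induction_on with
  | empty => simpa using core_inner_zero_left B w
  | insert a s ha ih => rw [Finset.sum_insert ha, Finset.sum_insert ha, B.add_left, ih]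

/-- The inner product pulled back along an injective linear map. -/
@[reducible]
def coreComap {W : Type*} [AddCommGroup W] [Module ℂ W] (f : W →ₗ[ℂ] V)
    (hf : Function.Injective f) : InnerProductSpace.Core ℂ W where
  inner x y := B.inner (f x) (f y)
  conj_inner_symm x y := B.conj_inner_symm _ _
  re_inner_nonneg x := B.re_inner_nonneg _
  add_left x y z := by
    rw [map_add, B.add_left]
  smul_left x y c := by
    change B.inner (f (c • x)) (f y) = _
    rw [map_smul, B.smul_left]
  definite x hx := hf (by rw [map_zero]; exact B.definite _ hx)

end Core

/-! ### Maschke's theorem in the form of equivariant projections. -/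

section Projection

variable {G : Type*} [Group G] [Finite G] {V : Type*} [AddCommGroup V] [Module ℂ V]

/-- Averaging the conjugates of an arbitrary linear projection makes it commute with the group; it
stays the identity on `U`. -/
theorem exists_equivariant_projection {ρ : Representation ℂ G V} (U : Subrepresentation ρ) :
    ∃ P : V →ₗ[ℂ] V, (∀ g v, P (ρ g v) = ρ g (P v)) ∧ (∀ v, P v ∈ U.toSubmodule) ∧
      ∀ u ∈ U.toSubmodule, P u = u := by
  classical
  have := Fintype.ofFinite G
  obtain ⟨q, hq⟩ := LinearMap.exists_leftInverse_of_injective U.toSubmodule.subtype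
    (Submodule.ker_subtype _)
  have hq' : ∀ u (hu : u ∈ U.toSubmodule), (q u : V) = u := fun u hu =>
    congrArg Subtype.val (LinearMap.congr_fun hq ⟨u, hu⟩)
  have hc : (Fintype.card G : ℂ) ≠ 0 := by simp
  refine ⟨(Fintype.card G : ℂ)⁻¹ • ∑ g, ρ g ∘ₗ U.toSubmodule.subtype ∘ₗ q ∘ₗ ρ g⁻¹,
    ?_, ?_, ?_⟩
  · intro g v
    simp only [LinearMap.smul_apply, LinearMap.sum_apply, LinearMap.comp_apply, map_smul, map_sum]
    congr 1
    refine Fintype.sum_equiv (Equiv.mulLeft g⁻¹) _ _ fun x => ?_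
    simp only [Equiv.coe_mulLeft, ← Module.End.mul_apply, ← map_mul]
    simp
  · intro v
    simp only [LinearMap.smul_apply, LinearMap.sum_apply, LinearMap.comp_apply]
    exact Submodule.smul_mem _ _ (Submodule.sum_mem _ fun g _ =>
      U.apply_mem_toSubmodule g (q _).2)
  · intro u hu
    simp only [LinearMap.smul_apply, LinearMap.sum_apply, LinearMap.comp_apply]
    rw [Finset.sum_congr rfl (g := fun _ => u)]
    · rw [Finset.sum_const, Finset.card_univ, ← Nat.cast_smul_eq_nsmul ℂ, smul_smul,
        inv_mul_cancel₀ hc, one_smul]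
    · intro g _
      rw [Submodule.subtype_apply, hq' _ (U.apply_mem_toSubmodule g⁻¹ hu),
        ← Module.End.mul_apply, ← map_mul]
      simp

end Projection

/-! ### The induced representation, the Gelfand criterion and spherical coefficients. -/

section Induced

variable {G : Type} [Group G] (H : Subgroup G)

/-- The canonical `H`-fixed generator of the induced representation. -/
def indGen : Representation.IndV H.subtype (Representation.trivial ℂ H ℂ) :=
  Representation.IndV.mk H.subtype (Representation.trivial ℂ H ℂ) 1 1

theorem ind_apply_indGen (g : G) : indOne H g (indGen H) =
    Representation.IndV.mk H.subtype (Representation.trivial ℂ H ℂ) g⁻¹ 1 := by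
  rw [indGen, Representation.ind_mk, one_mul]

/-- Frobenius reciprocity: an `H`-fixed vector is an `H`-map from the trivial representation. -/
theorem exists_intertwiningMap_of_fixed {V : Type} [AddCommGroup V] [Module ℂ V]
    (ρ : Representation ℂ G V) (v : V) (hv : ∀ h ∈ H, ρ h v = v) :
    ∃ f : (indOne H).IntertwiningMap ρ, f (indGen H) = v := by
  have hf : ∀ h : H, (LinearMap.toSpanSingleton ℂ V v) ∘ₗ (Representation.trivial ℂ H ℂ h) =
      (ρ.comp H.subtype) h ∘ₗ LinearMap.toSpanSingleton ℂ V v := by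
    intro h
    ext
    simpa using (hv h h.2).symm
  let F := (Rep.indResHomEquiv H.subtype (Rep.of (Representation.trivial ℂ H ℂ)) (Rep.of ρ)).symm
    (Rep.ofHom ⟨LinearMap.toSpanSingleton ℂ V v, hf⟩)
  refine ⟨F.hom, ?_⟩
  simp [F, indGen]

theorem ind_apply_indGen_of_mem {h : G} (hh : h ∈ H) : indOne H h (indGen H) = indGen H := by
  rw [ind_apply_indGen, indGen]
  have := Representation.Coinvariants.mk_self_apply
    (Representation.tprod ((Representation.leftRegular ℂ G).comp H.subtype)
      (Representation.trivial ℂ H ℂ)) (⟨h, hh⟩⁻¹ : H)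
      (MonoidAlgebra.single (1 : G) (1 : ℂ) ⊗ₜ[ℂ] (1 : ℂ))
  simpa using this

theorem span_ind_indGen : Submodule.span ℂ (Set.range fun g => indOne H g (indGen H)) = ⊤ := by
  rw [eq_top_iff]
  intro x _
  induction x using Representation.Coinvariants.induction_on with
  | _ x =>
    induction x using TensorProduct.induction_on with
    | zero => rw [map_zero]; exact Submodule.zero_mem _
    | add x y hx hy => rw [map_add]; exact Submodule.add_mem _ (hx trivial) (hy trivial)
    | tmul a c =>
      induction a using MonoidAlgebra.induction_linear with
      | zero => rw [TensorProduct.zero_tmul, map_zero]; exact Submodule.zero_mem _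
      | add a b ha hb =>
        rw [TensorProduct.add_tmul, map_add]; exact Submodule.add_mem _ (ha trivial) (hb trivial)
      | single g b =>
        have : (MonoidAlgebra.single g b ⊗ₜ[ℂ] c : TensorProduct ℂ (MonoidAlgebra ℂ G) ℂ) =
            (b * c) • (MonoidAlgebra.single g (1 : ℂ) ⊗ₜ[ℂ] (1 : ℂ)) := by
          rw [mul_smul, ← TensorProduct.tmul_smul, TensorProduct.smul_tmul']
          simp
        rw [this, map_smul]
        refine Submodule.smul_mem _ _ (Submodule.subset_span ⟨g⁻¹, ?_⟩)
        change indOne H g⁻¹ (indGen H) = _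
        rw [ind_apply_indGen, inv_inv]
        rfl

/-- If a commutative group acts transitively on `G / H`, every endomorphism of the induced
representation commuting with it preserves all subrepresentations. -/
theorem mem_of_commute {A : Type*} [CommGroup A] (ι : A →* G)
    (hι : ∀ g, ∃ a, ∃ h ∈ H, g = ι a * h)
    (T : Representation.IndV H.subtype (Representation.trivial ℂ H ℂ) →ₗ[ℂ]
      Representation.IndV H.subtype (Representation.trivial ℂ H ℂ))
    (hT : ∀ g v, T (indOne H g v) = indOne H g (T v)) (U : Subrepresentation (indOne H))
    {u} (hu : u ∈ U.toSubmodule) : T u ∈ U.toSubmodule := by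
  have hspan : Submodule.span ℂ (Set.range fun a => indOne H (ι a) (indGen H)) = ⊤ := by
    rw [← span_ind_indGen H]
    congr 1
    ext x
    constructor
    · rintro ⟨a, rfl⟩
      exact ⟨ι a, rfl⟩
    · rintro ⟨g, rfl⟩
      obtain ⟨a, h, hh, rfl⟩ := hι g
      refine ⟨a, ?_⟩
      simp only [map_mul, Module.End.mul_apply]
      rw [ind_apply_indGen_of_mem H hh]
  obtain ⟨c, hc⟩ := (Finsupp.mem_span_range_iff_exists_finsupp (x := T (indGen H))).1
    (hspan ▸ Submodule.mem_top :
      T (indGen H) ∈ Submodule.span ℂ (Set.range fun a => indOne H (ι a) (indGen H)))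
  -- It suffices to compare on the translates of the generator by `A`. There `T` commutes past the
  -- translation, and commutativity of `A` lets the expansion of `T (indGen H)` be applied before
  -- it.
  have key : T = c.sum fun a z => z • indOne H (ι a) := by
    refine LinearMap.ext_on_range hspan fun b => ?_
    rw [hT, ← hc, Finsupp.sum, Finsupp.sum, map_sum, LinearMap.sum_apply]
    refine Finset.sum_congr rfl fun a _ => ?_
    rw [map_smul, LinearMap.smul_apply, ← Module.End.mul_apply, ← Module.End.mul_apply,
      ← map_mul, ← map_mul, ← map_mul, ← map_mul, mul_comm]
  rw [key, Finsupp.sum, LinearMap.sum_apply]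
  exact Submodule.sum_mem _ fun a _ => Submodule.smul_mem _ _ (U.apply_mem_toSubmodule _ hu)

/-- Irreducibility plays no role: any two isomorphic subrepresentations contain each other. -/
theorem isGelfandPair_of_commGroup [Finite G] {A : Type*} [CommGroup A] (ι : A →* G)
    (hι : ∀ g, ∃ a, ∃ h ∈ H, g = ι a * h) : IsGelfandPair H := by
  have key : ∀ U W : Subrepresentation (indOne H),
      Nonempty (U.toRepresentation.Equiv W.toRepresentation) → W.toSubmodule ≤ U.toSubmodule := by
    rintro U W ⟨φ⟩ w hw
    obtain ⟨P, hP, hPU, hPid⟩ := exists_equivariant_projection U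
    let P' := LinearMap.codRestrict U.toSubmodule P hPU
    -- Project to `U`, then apply the isomorphism to `W`. This `T` maps `U` onto `W` but must also
    -- preserve `U`.
    let T := W.toSubmodule.subtype ∘ₗ φ.toLinearMap ∘ₗ P'
    have hT : ∀ g v, T (indOne H g v) = indOne H g (T v) := by
      intro g v
      have h1 : P' (indOne H g v) = U.toRepresentation g (P' v) := Subtype.ext (hP g v)
      change ((φ (P' (indOne H g v)) : W.toSubmodule) : _) = indOne H g (φ (P' v) : W.toSubmodule)
      rw [h1]
      exact congrArg Subtype.val (φ.toIntertwiningMap.isIntertwining _ _ g (P' v))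
    have hmem := mem_of_commute H ι hι T hT U (φ.symm ⟨w, hw⟩).2
    have h2 : P' (φ.symm ⟨w, hw⟩ : U.toSubmodule) = φ.symm ⟨w, hw⟩ :=
      Subtype.ext (hPid _ (φ.symm ⟨w, hw⟩).2)
    have h3 : T (φ.symm ⟨w, hw⟩ : U.toSubmodule) = w := by
      change ((φ (P' (φ.symm ⟨w, hw⟩ : U.toSubmodule)) : W.toSubmodule) : _) = w
      rw [h2, Representation.Equiv.apply_symm_apply]
    rwa [h3] at hmem
  intro U W _ _ hUW
  exact Subrepresentation.toSubmodule_injective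
    (le_antisymm (key W U (hUW.map Representation.Equiv.symm)) (key U W hUW))

/-- A fixed vector which spans the fixed vectors of the representation generated by it
comes from an irreducible subrepresentation of the induced representation. -/
theorem exists_irreducible_of_fixed [Finite G] {V : Type} [AddCommGroup V] [Module ℂ V]
    (ρ : Representation ℂ G V) (v : V) (hv : ∀ h ∈ H, ρ h v = v) (hv0 : v ≠ 0)
    (hfix : ∀ w, (∀ h ∈ H, ρ h w = w) → ∃ c : ℂ, w = c • v) :
    ∃ U : Subrepresentation (indOne H), U.toRepresentation.IsIrreducible ∧
      ∃ f : U.toRepresentation.IntertwiningMap ρ, Function.Injective f ∧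
        ∃ u : U.toSubmodule, f u = v ∧ ∀ h ∈ H, U.toRepresentation h u = u := by
  obtain ⟨f, hf⟩ := exists_intertwiningMap_of_fixed H ρ v hv
  obtain ⟨P, hP, hPK, hPid⟩ := exists_equivariant_projection f.ker
  -- The invariant complement of the kernel of `f`, on which `f` is injective; it is generated by
  -- the image `u` of `indGen H` under the complementary projection `Q`.
  let U : Subrepresentation (indOne H) :=
    { toSubmodule := LinearMap.ker P
      apply_mem_toSubmodule := fun g x hx => by
        rw [LinearMap.mem_ker] at hx ⊢
        rw [hP, hx, map_zero] }
  have hfP : ∀ x, f (P x) = 0 := fun x => hPK x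
  have hPP : ∀ x, P (P x) = P x := fun x => hPid _ (hPK x)
  let F : U.toRepresentation.IntertwiningMap ρ :=
    ⟨f.toLinearMap ∘ₗ U.toSubmodule.subtype, fun g => by
      ext x
      exact f.isIntertwining _ _ g x⟩
  have hF : ∀ x : U.toSubmodule, F x = f (x : _) := fun _ => rfl
  have hFinj : Function.Injective F := by
    rw [← Representation.IntertwiningMap.coe_toLinearMap, ← LinearMap.ker_eq_bot,
      LinearMap.ker_eq_bot']
    intro x hx
    have h1 : P x = x := hPid _ hx
    have h2 : P x = 0 := x.2
    exact Subtype.ext (h1.symm.trans h2)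
  let Q : Representation.IndV H.subtype (Representation.trivial ℂ H ℂ) →ₗ[ℂ] U.toSubmodule :=
    LinearMap.codRestrict _ (LinearMap.id - P) fun x => by
      change P (x - P x) = 0
      rw [map_sub, hPP, sub_self]
  have hQ : ∀ x : U.toSubmodule, Q x = x := fun x => Subtype.ext (by
    change (x : _) - P x = x
    rw [show P x = 0 from x.2, sub_zero])
  have hQg : ∀ g x, Q (indOne H g x) = U.toRepresentation g (Q x) := fun g x => Subtype.ext (by
    change indOne H g x - P (indOne H g x) = indOne H g (x - P x)
    rw [hP, map_sub])
  set u := Q (indGen H) with hu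
  have hFu : F u = v := by
    rw [hF]
    change f (indGen H - P (indGen H)) = v
    rw [map_sub, hfP, sub_zero, hf]
  have hufix : ∀ h ∈ H, U.toRepresentation h u = u := fun h hh => by
    rw [hu, ← hQg, ind_apply_indGen_of_mem H hh]
  have hspan : Submodule.span ℂ (Set.range fun g => U.toRepresentation g u) = ⊤ := by
    have h1 : Submodule.map Q ⊤ = ⊤ := by
      rw [Submodule.map_top, LinearMap.range_eq_top]
      exact fun x => ⟨x, hQ x⟩
    rw [← h1, ← span_ind_indGen H, Submodule.map_span, ← Set.range_comp]
    congr 2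
    funext g
    exact (hQg g _).symm
  refine ⟨U, ?_, F, hFinj, u, hFu, hufix⟩
  have hu0 : u ≠ 0 := by
    rintro h0
    rw [h0, map_zero] at hFu
    exact hv0 hFu.symm
  have hne : (⊥ : Subrepresentation U.toRepresentation) ≠ ⊤ := by
    intro hbt
    have : u ∈ (⊥ : Subrepresentation U.toRepresentation).toSubmodule := by
      rw [hbt]; exact Submodule.mem_top
    exact hu0 this
  refine { exists_pair_ne := ⟨_, _, hne⟩, eq_bot_or_eq_top := fun U' => ?_ }
  obtain ⟨P', hP', hPU', hPid'⟩ := exists_equivariant_projection U'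
  -- The projection of `u` to `U'` is again `H`-fixed, hence a multiple `c` of `u`. If `c` is zero
  -- the projection kills the generator and `U'` is zero; otherwise `U'` contains the generator.
  obtain ⟨c, hc⟩ := hfix (F (P' u)) fun h hh => by
    rw [← F.isIntertwining, ← hP', hufix h hh]
  have hPu : P' u = c • u := hFinj (by rw [hc, map_smul, hFu])
  by_cases hc0 : c = 0
  · left
    have hz : P' = 0 := LinearMap.ext_on_range hspan fun g => by
      rw [hP', hPu, hc0, zero_smul, map_zero, LinearMap.zero_apply]
    apply Subrepresentation.toSubmodule_injective
    refine (Submodule.eq_bot_iff _).2 fun x hx => ?_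
    rw [← hPid' x hx, hz, LinearMap.zero_apply]
  · right
    have hmem : u ∈ U'.toSubmodule := by
      have := U'.toSubmodule.smul_mem c⁻¹ (hPU' u)
      rwa [hPu, smul_smul, inv_mul_cancel₀ hc0, one_smul] at this
    apply Subrepresentation.toSubmodule_injective
    refine eq_top_iff.2 ?_
    change (⊤ : Submodule ℂ U.toSubmodule) ≤ _
    rw [← hspan, Submodule.span_le]
    rintro _ ⟨g, rfl⟩
    exact U'.apply_mem_toSubmodule g hmem

theorem isSphericalCoefficient_comap {V W : Type} [AddCommGroup V] [Module ℂ V]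
    [AddCommGroup W] [Module ℂ W] {ρ : Representation ℂ G V} {τ : Representation ℂ G W}
    (f : τ.IntertwiningMap ρ) (hf : Function.Injective f) (B : InnerProductSpace.Core ℂ V)
    (hB : ∀ (g : G) (v w : V), B.inner (ρ g v) (ρ g w) = B.inner v w) (u : W)
    (hu : ∀ h ∈ H, τ h u = u) (hu1 : B.inner (f u) (f u) = 1) :
    IsSphericalCoefficient H τ fun g => B.inner (ρ g (f u)) (f u) := by
  refine ⟨coreComap B f.toLinearMap hf, fun g v w => ?_, u, hu, hu1, fun g => ?_⟩
  · change B.inner (f (τ g v)) (f (τ g w)) = B.inner (f v) (f w)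
    rw [f.isIntertwining, f.isIntertwining, hB]
  · change _ = B.inner (f (τ g u)) (f u)
    rw [f.isIntertwining]

/-- A spherical coefficient of an irreducible representation of `G = A H` is the average over `H`
of the conjugates of any character of `A` occurring in the representation. -/
theorem inner_apply_fixed_eq_average [Fintype H] {A : Type*} (ι : A → G)
    (hι : ∀ g, ∃ a, ∃ h ∈ H, g = ι a * h) (c : H → A → A)
    (hc : ∀ h a, ι a * h = h * ι (c h a)) {V : Type} [AddCommGroup V] [Module ℂ V]
    {ρ : Representation ℂ G V} (hρ : ρ.IsIrreducible) (B : InnerProductSpace.Core ℂ V)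
    (hB : ∀ (g : G) (v w : V), B.inner (ρ g v) (ρ g w) = B.inner v w) (v : V)
    (hv : ∀ h ∈ H, ρ h v = v) (hv1 : B.inner v v = 1) (u : V) (hu : u ≠ 0) (χ : A → ℂ)
    (hχ : ∀ a, ρ (ι a) u = χ a • u) (a : A) (a₁ : A) (ha₁ : ι a₁ = 1) :
    B.inner (ρ (ι a) v) v = (Fintype.card H : ℂ)⁻¹ * ∑ h, star (χ (c h a)) := by
  have hcard : (Fintype.card H : ℂ) ≠ 0 := by simp
  have hact : ∀ a (h : H), ρ (ι a) (ρ h u) = χ (c h a) • ρ h u := fun a h => by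
    rw [← Module.End.mul_apply, ← map_mul, hc, map_mul, Module.End.mul_apply, hχ, map_smul]
  -- The `H`-translates of `u` are eigenvectors of `A` for twisted characters, so their span is
  -- stable under `A * H` and by irreducibility is the whole space. Averaging over `H` then makes
  -- `v` a multiple of the sum of these translates.
  let S : Subrepresentation ρ :=
    { toSubmodule := Submodule.span ℂ (Set.range fun h : H => ρ h u)
      apply_mem_toSubmodule := fun g x hx => by
        have hle : Submodule.span ℂ (Set.range fun h : H => ρ h u) ≤
            (Submodule.span ℂ (Set.range fun h : H => ρ h u)).comap (ρ g) := by
          rw [Submodule.span_le]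
          rintro _ ⟨h, rfl⟩
          obtain ⟨a, h', hh', rfl⟩ := hι g
          change ρ (ι a * h') (ρ h u) ∈ Submodule.span ℂ (Set.range fun h : H => ρ h u)
          rw [map_mul, Module.End.mul_apply, ← Module.End.mul_apply (ρ h'), ← map_mul]
          have := hact a (⟨h', hh'⟩ * h)
          rw [Subgroup.coe_mul] at this
          rw [this]
          exact Submodule.smul_mem _ _ (Submodule.subset_span ⟨⟨h', hh'⟩ * h, rfl⟩)
        exact hle hx }
  have hS : S = ⊤ := by
    refine (hρ.eq_bot_or_eq_top S).resolve_left fun h0 => hu ?_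
    have : u ∈ S.toSubmodule := Submodule.subset_span ⟨1, by simp⟩
    rw [h0] at this
    exact this
  have hvS : v ∈ Submodule.span ℂ (Set.range fun h : H => ρ h u) := by
    change v ∈ S.toSubmodule
    rw [hS]; exact Submodule.mem_top
  have havg : ∀ x ∈ Submodule.span ℂ (Set.range fun h : H => ρ h u),
      ∃ z : ℂ, ∑ h : H, ρ h x = z • ∑ h : H, ρ h u := by
    intro x hx
    induction hx using Submodule.span_induction with
    | mem x hx =>
      obtain ⟨h', rfl⟩ := hx
      refine ⟨1, ?_⟩
      rw [one_smul]
      refine Fintype.sum_equiv (Equiv.mulRight h') _ _ fun h => ?_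
      simp
    | zero => exact ⟨0, by simp⟩
    | add x y _ _ hx hy =>
      obtain ⟨z, hz⟩ := hx
      obtain ⟨w, hw⟩ := hy
      exact ⟨z + w, by simp only [map_add, Finset.sum_add_distrib, hz, hw, add_smul]⟩
    | smul t x _ hx =>
      obtain ⟨z, hz⟩ := hx
      exact ⟨t * z, by simp only [map_smul, ← Finset.smul_sum, hz, mul_smul]⟩
  obtain ⟨z, hz⟩ := havg v hvS
  have hvz : v = ((Fintype.card H : ℂ)⁻¹ * z) • ∑ h : H, ρ h u := by
    rw [mul_smul, ← hz, Finset.sum_congr rfl fun (h : H) _ => hv h h.2, Finset.sum_const,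
      Finset.card_univ, ← Nat.cast_smul_eq_nsmul ℂ, smul_smul, inv_mul_cancel₀ hcard, one_smul]
  have hinv : ∀ h : H, B.inner (ρ h u) v = B.inner u v := fun h => by
    conv_lhs => rw [← hv h h.2]
    exact hB _ _ _
  obtain ⟨y, hy⟩ : ∃ y : ℂ, v = y • ∑ h : H, ρ h u := ⟨_, hvz⟩
  have hform : ∀ a, B.inner (ρ (ι a) v) v =
      star y * B.inner u v * ∑ h, star (χ (c h a)) := fun a => by
    conv_lhs => rw [show ρ (ι a) v = ρ (ι a) (y • ∑ h : H, ρ h u) from congrArg _ hy]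
    rw [map_smul, map_sum, B.smul_left, core_inner_sum_left, Finset.mul_sum, Finset.mul_sum]
    refine Finset.sum_congr rfl fun h _ => ?_
    rw [hact, B.smul_left, hinv]
    change star y * (star (χ (c h a)) * _) = _
    ring
  -- Evaluating at the identity of the group fixes the unknown scalar in `hform`, because `v` has
  -- norm one.
  have hone : ∀ h, χ (c h a₁) = 1 := fun h => by
    have h1 : ι (c h a₁) = 1 := by
      have := hc h a₁
      rw [ha₁, one_mul] at this
      exact mul_left_cancel (a := (h : G)) (by rw [mul_one, ← this])
    have h2 := hχ (c h a₁)
    rw [h1, map_one, Module.End.one_apply] at h2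
    have h3 : (χ (c h a₁) - 1) • u = 0 := by rw [sub_smul, one_smul, ← h2, sub_self]
    exact sub_eq_zero.1 ((smul_eq_zero.1 h3).resolve_right hu)
  have h1 := hform a₁
  rw [ha₁, map_one, Module.End.one_apply, hv1] at h1
  simp only [hone, star_one, Finset.sum_const, Finset.card_univ, nsmul_eq_mul, mul_one] at h1
  rw [hform, eq_inv_of_mul_eq_one_left h1.symm]

end Induced

/-! ### Recursions for the hypergeometric sum at nonpositive integers. -/

section Hypergeometric

theorem eval_neg_ascPochhammer (l m : ℕ) :
    (ascPochhammer ℂ m).eval (-(l : ℂ)) = (-1) ^ m * (l.descFactorial m : ℂ) := by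
  rw [ascPochhammer_eval_neg_eq_descPochhammer, descPochhammer_eval_eq_descFactorial]

/-- For `m > l` the complex factor is not truncated, but the falling factorial beside it vanishes.
-/
theorem cast_descFactorial_succ (l m : ℕ) :
    (l.descFactorial (m + 1) : ℂ) = ((l : ℂ) - m) * l.descFactorial m := by
  rw [Nat.descFactorial_succ, Nat.cast_mul]
  rcases le_or_gt m l with h | h
  · rw [Nat.cast_sub h]
  · rw [Nat.descFactorial_of_lt h]; simp

theorem succ_mul_cast_descFactorial (l m : ℕ) :
    ((l : ℂ) + 1) * l.descFactorial m = ((l : ℂ) + 1 - m) * (l + 1).descFactorial m := by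
  have := cast_descFactorial_succ (l + 1) m
  rw [Nat.succ_descFactorial_succ] at this
  push_cast at this
  exact this

theorem cast_mul_pred_descFactorial (l m : ℕ) :
    (l : ℂ) * ((l - 1).descFactorial m : ℂ) = ((l : ℂ) - m) * l.descFactorial m := by
  rw [← cast_descFactorial_succ]
  cases l with
  | zero => simp
  | succ l => rw [Nat.succ_descFactorial_succ]; push_cast; rfl

theorem succ_descFactorial_eq_add (l m : ℕ) :
    ((l + 1).descFactorial m : ℂ) = l.descFactorial m + m * l.descFactorial (m - 1) := by
  cases m with
  | zero => simp
  | succ m =>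
    rw [cast_descFactorial_succ l, Nat.succ_descFactorial_succ]
    push_cast
    ring

theorem prod_eq_mul_prod_of_eq_off {α M : Type*} [Fintype α] [CommMonoid M] {f g : α → M}
    (a : α) (c : M) (ha : f a = c * g a) (h : ∀ x, x ≠ a → f x = g x) :
    ∏ x, f x = c * ∏ x, g x := by
  classical
  rw [Fintype.prod_eq_mul_prod_compl a f, Fintype.prod_eq_mul_prod_compl a g, ha, mul_assoc]
  congr 2
  refine Finset.prod_congr rfl fun x hx => h x (by simpa using hx)

variable {ι κ : Type} [Fintype ι] [Fintype κ]

/-- The summands of the hypergeometric series at nonpositive integral parameters. -/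
def hyperTerm (X : ι → κ → ℂ) (l : ι → ℕ) (k : κ → ℕ) (n : ℕ) (m : ι → κ → ℕ) : ℂ :=
  (∏ i, ((l i).descFactorial (∑ j, m i j) : ℂ)) * (∏ j, ((k j).descFactorial (∑ i, m i j) : ℂ)) /
      (n.descFactorial (∑ i, ∑ j, m i j) : ℂ) *
    ((∏ i, ∏ j, (-X i j) ^ m i j) / ∏ i, ∏ j, ((m i j).factorial : ℂ))

theorem entry_le_total (m : ι → κ → ℕ) (i : ι) (j : κ) : m i j ≤ ∑ i, ∑ j, m i j :=
  (Finset.single_le_sum (f := fun j => m i j) (fun _ _ => Nat.zero_le _)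
    (Finset.mem_univ j)).trans
    (Finset.single_le_sum (f := fun i => ∑ j, m i j) (fun _ _ => Nat.zero_le _)
      (Finset.mem_univ i))

/-- Beyond total `n` the denominator is zero, and division by zero gives zero. The truncation is
thus built into the summand, and the sum may run over all matrices, where reindexing is free. -/
theorem total_le_of_hyperTerm_ne_zero {X : ι → κ → ℂ} {l : ι → ℕ} {k : κ → ℕ} {n : ℕ}
    {m : ι → κ → ℕ} (h : hyperTerm X l k n m ≠ 0) : ∑ i, ∑ j, m i j ≤ n := by
  by_contra! hlt
  apply h
  rw [hyperTerm, Nat.descFactorial_of_lt hlt, Nat.cast_zero, div_zero, zero_mul]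

theorem finite_setOf_total_le (n : ℕ) : {m : ι → κ → ℕ | ∑ i, ∑ j, m i j ≤ n}.Finite := by
  classical
  refine (Set.finite_Iic (fun (_ : ι) (_ : κ) => n)).subset fun m hm i j => ?_
  exact (entry_le_total m i j).trans hm

theorem summable_hyperTerm (X : ι → κ → ℂ) (l : ι → ℕ) (k : κ → ℕ) (n : ℕ) :
    Summable (hyperTerm X l k n) :=
  summable_of_hasFiniteSupport ((finite_setOf_total_le n).subset fun _ hm =>
    total_le_of_hyperTerm_ne_zero hm)

theorem hyperF_neg_eq_tsum [DecidableEq ι] [DecidableEq κ] (X : ι → κ → ℂ) (l : ι → ℕ)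
    (k : κ → ℕ) (n : ℕ) :
    hyperF (fun i => -(l i : ℂ)) (fun j => -(k j : ℂ)) n (Matrix.of X) =
      ∑' m, hyperTerm X l k n m := by
  let e : (ι → κ → Fin (n + 1)) ↪ (ι → κ → ℕ) :=
    ⟨fun a i j => a i j, fun a b h => by
      funext i j
      exact Fin.ext (congrFun (congrFun h i) j)⟩
  rw [tsum_eq_sum (s := ((Finset.univ : Finset (ι → κ → Fin (n + 1))).filter
    fun a => ∑ i, ∑ j, (a i j : ℕ) ≤ n).map e), Finset.sum_map]
  · refine Finset.sum_congr rfl fun a _ => ?_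
    rw [hyperTerm]
    simp only [eval_neg_ascPochhammer, Finset.prod_mul_distrib, Finset.prod_pow_eq_pow_sum,
      Matrix.of_apply, neg_pow (X _ _), e]
    rw [Finset.sum_comm (f := fun j i => ((a i j : Fin (n + 1)) : ℕ))]
    -- Rows, columns and denominator each contribute the sign of the total; one copy survives and is
    -- absorbed into the powers of `-X i j`.
    have hs : ((-1 : ℂ) ^ (∑ i, ∑ j, (a i j : ℕ))) * (-1) ^ (∑ i, ∑ j, (a i j : ℕ)) = 1 := by
      rw [← mul_pow]; simp
    have hs' : ((-1 : ℂ) ^ (∑ i, ∑ j, (a i j : ℕ)))⁻¹ = (-1) ^ (∑ i, ∑ j, (a i j : ℕ)) :=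
      inv_eq_of_mul_eq_one_left hs
    rw [div_eq_mul_inv, mul_inv, hs']
    linear_combination (((∏ i, ((l i).descFactorial (∑ j, (a i j : ℕ)) : ℂ)) *
      (∏ j, ((k j).descFactorial (∑ i, (a i j : ℕ)) : ℂ)) *
      (n.descFactorial (∑ i, ∑ j, (a i j : ℕ)) : ℂ)⁻¹ * (-1) ^ (∑ i, ∑ j, (a i j : ℕ)) *
    ((∏ i, ∏ j, (X i j) ^ (a i j : ℕ)) / ∏ i, ∏ j, ((a i j : ℕ).factorial : ℂ)))) * hs
  · intro m hm
    by_contra h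
    apply hm
    have hle := total_le_of_hyperTerm_ne_zero h
    rw [Finset.mem_map]
    refine ⟨fun i j => ⟨m i j, Nat.lt_succ_of_le ((entry_le_total m i j).trans hle)⟩, ?_, rfl⟩
    simpa using hle

variable [DecidableEq κ]

theorem mul_prod_descFactorial_sub_single (k M : κ → ℕ) (j : κ) :
    (k j : ℂ) * ∏ x, (((k - Pi.single j 1 : κ → ℕ) x).descFactorial (M x) : ℂ) =
      ((k j : ℂ) - M j) * ∏ x, ((k x).descFactorial (M x) : ℂ) := by
  classical
  rw [Fintype.prod_eq_mul_prod_compl j, Fintype.prod_eq_mul_prod_compl j (fun x =>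
    ((k x).descFactorial (M x) : ℂ)), ← mul_assoc, ← mul_assoc]
  congr 1
  · simpa using cast_mul_pred_descFactorial (k j) (M j)
  · refine Finset.prod_congr rfl fun x hx => ?_
    have : x ≠ j := by simpa using hx
    simp [this]

theorem prod_descFactorial_add_single (k M : κ → ℕ) (j : κ) :
    ∏ x, ((k x).descFactorial (M x + (Pi.single j 1 : κ → ℕ) x) : ℂ) =
      (k j : ℂ) * ∏ x, (((k - Pi.single j 1 : κ → ℕ) x).descFactorial (M x) : ℂ) := by
  refine prod_eq_mul_prod_of_eq_off j _ ?_ fun x hx => by simp [hx]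
  rw [Pi.single_eq_same, cast_descFactorial_succ]
  simpa using (cast_mul_pred_descFactorial (k j) (M j)).symm

/-- With `M` the total of `m`, raising `n` contributes the factor `n + 1 - M`, and the weighted
terms with lowered `k j` contribute `∑ k j - M`. The identity fails to be formal only for `M > n`,
where `hl` forces some row sum to exceed `l i` and all terms vanish. -/
theorem succ_mul_hyperTerm (X : ι → κ → ℂ) (l : ι → ℕ) (k : κ → ℕ) (n : ℕ) (hl : ∑ i, l i ≤ n)
    (m : ι → κ → ℕ) :
    ((n : ℂ) + 1) * hyperTerm X l k (n + 1) m =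
      ((n : ℂ) + 1 - ∑ j, (k j : ℂ)) * hyperTerm X l k n m +
        ∑ j, (k j : ℂ) * hyperTerm X l (k - Pi.single j 1) n m := by
  rcases le_or_gt (∑ i, ∑ j, m i j) n with hN | hN
  · have h1 := succ_mul_cast_descFactorial n (∑ i, ∑ j, m i j)
    have h2 : (n.descFactorial (∑ i, ∑ j, m i j) : ℂ) ≠ 0 := by
      rw [Nat.cast_ne_zero]; exact fun h => by
        rw [Nat.descFactorial_eq_zero_iff_lt] at h; omega
    have h3 : ((n + 1).descFactorial (∑ i, ∑ j, m i j) : ℂ) ≠ 0 := by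
      rw [Nat.cast_ne_zero]; exact fun h => by
        rw [Nat.descFactorial_eq_zero_iff_lt] at h; omega
    have h4 : ∑ j, (k j : ℂ) * hyperTerm X l (k - Pi.single j 1) n m =
        (∑ j, (k j : ℂ) - ((∑ i, ∑ j, m i j : ℕ) : ℂ)) * hyperTerm X l k n m := by
      rw [Finset.sum_comm (f := fun i j => m i j), Nat.cast_sum, ← Finset.sum_sub_distrib,
        Finset.sum_mul]
      refine Finset.sum_congr rfl fun j _ => ?_
      have := mul_prod_descFactorial_sub_single k (fun j => ∑ i, m i j) j
      simp only [hyperTerm]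
      linear_combination (∏ i, ((l i).descFactorial (∑ j, m i j) : ℂ)) /
        (n.descFactorial (∑ i, ∑ j, m i j) : ℂ) *
        ((∏ i, ∏ j, (-X i j) ^ m i j) / ∏ i, ∏ j, ((m i j).factorial : ℂ)) * this
    have h5 : ((n : ℂ) + 1) / ((n + 1).descFactorial (∑ i, ∑ j, m i j) : ℂ) =
        ((n : ℂ) + 1 - ((∑ i, ∑ j, m i j : ℕ) : ℂ)) /
          (n.descFactorial (∑ i, ∑ j, m i j) : ℂ) := by
      rw [div_eq_div_iff h3 h2, h1]
    rw [h4]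
    simp only [hyperTerm]
    linear_combination (∏ i, ((l i).descFactorial (∑ j, m i j) : ℂ)) *
      (∏ j, ((k j).descFactorial (∑ i, m i j) : ℂ)) *
      ((∏ i, ∏ j, (-X i j) ^ m i j) / ∏ i, ∏ j, ((m i j).factorial : ℂ)) * h5
  · obtain ⟨i, hi⟩ : ∃ i, l i < ∑ j, m i j := by
      by_contra! h
      exact absurd ((Finset.sum_le_sum fun i _ => h i).trans hl) (not_le.2 hN)
    have h0 : ∏ i, ((l i).descFactorial (∑ j, m i j) : ℂ) = 0 :=
      Finset.prod_eq_zero (Finset.mem_univ i) (by rw [Nat.descFactorial_of_lt hi, Nat.cast_zero])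
    simp [hyperTerm, h0]

variable [DecidableEq ι]

/-- The part of `hyperTerm` with first parameter raised in the row `i` which is divisible by an
entry of the row. -/
def hyperShift (X : ι → κ → ℂ) (l : ι → ℕ) (k : κ → ℕ) (n : ℕ) (i : ι) (m : ι → κ → ℕ) : ℂ :=
  (∏ x, ((l x).descFactorial (∑ j, m x j - (Pi.single i 1 : ι → ℕ) x) : ℂ)) *
      (∏ j, ((k j).descFactorial (∑ i, m i j) : ℂ)) /
      (n.descFactorial (∑ i, ∑ j, m i j) : ℂ) *
    ((∏ i, ∏ j, (-X i j) ^ m i j) / ∏ i, ∏ j, ((m i j).factorial : ℂ))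

theorem prod_add_single_descFactorial (l M : ι → ℕ) (i : ι) :
    ∏ x, (((l + Pi.single i 1 : ι → ℕ) x).descFactorial (M x) : ℂ) =
      ∏ x, ((l x).descFactorial (M x) : ℂ) +
        M i * ∏ x, ((l x).descFactorial (M x - (Pi.single i 1 : ι → ℕ) x) : ℂ) := by
  rw [Fintype.prod_eq_mul_prod_compl i, Fintype.prod_eq_mul_prod_compl i (fun x =>
    ((l x).descFactorial (M x) : ℂ)), Fintype.prod_eq_mul_prod_compl i (fun x =>
    ((l x).descFactorial (M x - (Pi.single i 1 : ι → ℕ) x) : ℂ))]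
  have h1 : ∏ x ∈ {i}ᶜ, (((l + Pi.single i 1 : ι → ℕ) x).descFactorial (M x) : ℂ) =
      ∏ x ∈ {i}ᶜ, ((l x).descFactorial (M x) : ℂ) :=
    Finset.prod_congr rfl fun x hx => by
      have : x ≠ i := by simpa using hx
      simp [this]
  have h2 : ∏ x ∈ {i}ᶜ, ((l x).descFactorial (M x - (Pi.single i 1 : ι → ℕ) x) : ℂ) =
      ∏ x ∈ {i}ᶜ, ((l x).descFactorial (M x) : ℂ) :=
    Finset.prod_congr rfl fun x hx => by
      have : x ≠ i := by simpa using hx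
      simp [this]
  rw [h1, h2]
  simp only [Pi.add_apply, Pi.single_eq_same, succ_descFactorial_eq_add]
  ring

/-- Pascal's rule for falling factorials in row `i`; the factor, the row sum, is then split over its
entries. -/
theorem hyperTerm_add_single (X : ι → κ → ℂ) (l : ι → ℕ) (k : κ → ℕ) (n : ℕ) (i : ι)
    (m : ι → κ → ℕ) :
    hyperTerm X (l + Pi.single i 1) k n m =
      hyperTerm X l k n m + ∑ j, (m i j : ℂ) * hyperShift X l k n i m := by
  rw [← Finset.sum_mul, ← Nat.cast_sum, hyperTerm, hyperTerm, hyperShift,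
    prod_add_single_descFactorial l (fun i => ∑ j, m i j) i]
  ring

/-- The entry `(i, j)` cancels against its factorial. The extra unit in that entry releases `k j`,
`n + 1` and `-X i j`, and the shift in row `i` restores the original row sum. -/
theorem mul_hyperShift_add_single (X : ι → κ → ℂ) (l : ι → ℕ) (k : κ → ℕ) (n : ℕ) (i : ι)
    (j : κ) (m : ι → κ → ℕ) :
    (((m + Pi.single i (Pi.single j 1) : ι → κ → ℕ) i j : ℕ) : ℂ) *
        hyperShift X l k (n + 1) i (m + Pi.single i (Pi.single j 1)) =
      -((n : ℂ) + 1)⁻¹ * (k j * X i j) * hyperTerm X l (k - Pi.single j 1) n m := by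
  set E : ι → κ → ℕ := Pi.single i (Pi.single j 1) with hE
  have hEi : E i = Pi.single j 1 := by simp [hE]
  have hEx : ∀ x, x ≠ i → E x = 0 := fun x hx => by simp [hE, hx]
  have hrow : ∀ x, ∑ y, (m + E) x y = ∑ y, m x y + (Pi.single i 1 : ι → ℕ) x := fun x => by
    simp only [Pi.add_apply, Finset.sum_add_distrib]
    congr 1
    by_cases hx : x = i
    · subst hx; rw [hEi]; simp
    · rw [hEx x hx]; simp [hx]
  have hcol : ∀ y, ∑ x, (m + E) x y = ∑ x, m x y + (Pi.single j 1 : κ → ℕ) y := fun y => by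
    simp only [Pi.add_apply, Finset.sum_add_distrib]
    congr 1
    rw [Finset.sum_eq_single i (fun x _ hx => by rw [hEx x hx]; rfl) (by simp), hEi]
  have htot : ∑ x, ∑ y, (m + E) x y = ∑ x, ∑ y, m x y + 1 := by
    simp only [hrow, Finset.sum_add_distrib]
    simp
  have hX : ∏ x, ∏ y, (-X x y) ^ (m + E) x y = -X i j * ∏ x, ∏ y, (-X x y) ^ m x y := by
    refine prod_eq_mul_prod_of_eq_off i _ ?_ fun x hx => by simp [hEx x hx]
    refine prod_eq_mul_prod_of_eq_off j _ ?_ fun y hy => by simp [hEi, hy]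
    simp [hEi, pow_succ, mul_comm]
  have hfac : ∏ x, ∏ y, (((m + E) x y).factorial : ℂ) =
      (m + E) i j * ∏ x, ∏ y, ((m x y).factorial : ℂ) := by
    refine prod_eq_mul_prod_of_eq_off i _ ?_ fun x hx => by simp [hEx x hx]
    refine prod_eq_mul_prod_of_eq_off j _ ?_ fun y hy => by simp [hEi, hy]
    simp [hEi, Nat.factorial_succ]
  have hne : ((m + E) i j : ℂ) ≠ 0 := by
    rw [Nat.cast_ne_zero]; simp [hEi]
  have hn : (n : ℂ) + 1 ≠ 0 := Nat.cast_add_one_ne_zero n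
  simp only [hyperShift, hyperTerm, hX, hfac, htot]
  simp only [hrow, hcol, Nat.add_sub_cancel, prod_descFactorial_add_single k,
    Nat.succ_descFactorial_succ]
  push_cast
  have hfin : (((m + E) i j : ℂ)) * (((m + E) i j : ℂ))⁻¹ = 1 := mul_inv_cancel₀ hne
  simp only [div_eq_mul_inv, mul_inv]
  linear_combination (-((n : ℂ) + 1)⁻¹ * (k j * X i j) *
    ((∏ i, ((l i).descFactorial (∑ j, m i j) : ℂ)) *
      (∏ x, (((k - Pi.single j 1 : κ → ℕ) x).descFactorial (∑ i, m i x) : ℂ)) *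
      (n.descFactorial (∑ i, ∑ j, m i j) : ℂ)⁻¹ *
    ((∏ i, ∏ j, (-X i j) ^ m i j) * (∏ i, ∏ j, ((m i j).factorial : ℂ))⁻¹))) * hfin

theorem tsum_mul_hyperShift (X : ι → κ → ℂ) (l : ι → ℕ) (k : κ → ℕ) (n : ℕ) (i : ι) (j : κ) :
    ∑' m : ι → κ → ℕ, (m i j : ℂ) * hyperShift X l k (n + 1) i m =
      -((n : ℂ) + 1)⁻¹ * (k j * X i j) * ∑' m, hyperTerm X l (k - Pi.single j 1) n m := by
  rw [← tsum_mul_left]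
  have hinj : Function.Injective
      fun m : ι → κ → ℕ => m + Pi.single i (Pi.single j 1) := add_left_injective _
  rw [← hinj.tsum_eq]
  · exact tsum_congr fun m => mul_hyperShift_add_single X l k n i j m
  -- Matrices outside the image of the shift have entry `(i, j)` equal to zero, so they contribute
  -- nothing.
  · intro m hm
    have hm0 : m i j ≠ 0 := fun h => hm (by simp [h])
    refine ⟨m - Pi.single i (Pi.single j 1), ?_⟩
    refine tsub_add_cancel_of_le fun x y => ?_
    by_cases hx : x = i
    · subst hx
      by_cases hy : y = j
      · subst hy; simpa using Nat.one_le_iff_ne_zero.2 hm0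
      · simp [hy]
    · simp [hx]

theorem succ_mul_tsum_hyperTerm (X : ι → κ → ℂ) (l : ι → ℕ) (k : κ → ℕ) (n : ℕ)
    (hl : ∑ i, l i ≤ n) :
    ((n : ℂ) + 1) * ∑' m, hyperTerm X l k (n + 1) m =
      ((n : ℂ) + 1 - ∑ j, (k j : ℂ)) * ∑' m, hyperTerm X l k n m +
        ∑ j, (k j : ℂ) * ∑' m, hyperTerm X l (k - Pi.single j 1) n m := by
  simp only [← tsum_mul_left]
  rw [← Summable.tsum_finsetSum fun j _ => (summable_hyperTerm X l _ n).mul_left _,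
    ← Summable.tsum_add ((summable_hyperTerm X l k n).mul_left _)
      (summable_sum fun j _ => (summable_hyperTerm X l _ n).mul_left _)]
  exact tsum_congr fun m => succ_mul_hyperTerm X l k n hl m

theorem summable_mul_hyperShift (X : ι → κ → ℂ) (l : ι → ℕ) (k : κ → ℕ) (n : ℕ) (i : ι) (j : κ) :
    Summable fun m : ι → κ → ℕ => (m i j : ℂ) * hyperShift X l k n i m := by
  refine summable_of_hasFiniteSupport ((finite_setOf_total_le n).subset fun m hm => ?_)
  by_contra! hlt
  apply hm
  change ¬ (∑ i, ∑ j, m i j ≤ n) at hlt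
  simp [hyperShift, Nat.descFactorial_of_lt (not_le.1 hlt)]

theorem succ_mul_tsum_hyperTerm_add_single (X : ι → κ → ℂ) (l : ι → ℕ) (k : κ → ℕ) (n : ℕ)
    (hl : ∑ i, l i ≤ n) (i : ι) :
    ((n : ℂ) + 1) * ∑' m, hyperTerm X (l + Pi.single i 1) k (n + 1) m =
      ((n : ℂ) + 1 - ∑ j, (k j : ℂ)) * ∑' m, hyperTerm X l k n m +
        ∑ j, (k j : ℂ) * ((1 - X i j) * ∑' m, hyperTerm X l (k - Pi.single j 1) n m) := by
  have hn : (n : ℂ) + 1 ≠ 0 := Nat.cast_add_one_ne_zero n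
  have h : ∑' m, hyperTerm X (l + Pi.single i 1) k (n + 1) m =
      ∑' m, hyperTerm X l k (n + 1) m + ∑ j, -((n : ℂ) + 1)⁻¹ * (k j * X i j) *
        ∑' m, hyperTerm X l (k - Pi.single j 1) n m := by
    simp only [← tsum_mul_hyperShift]
    rw [← Summable.tsum_finsetSum fun j _ => summable_mul_hyperShift X l k _ i j,
      ← Summable.tsum_add (summable_hyperTerm X l k _)
        (summable_sum fun j _ => summable_mul_hyperShift X l k _ i j)]
    exact tsum_congr fun m => hyperTerm_add_single X l k _ i m
  rw [h, mul_add, succ_mul_tsum_hyperTerm X l k n hl, Finset.mul_sum, add_assoc,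
    ← Finset.sum_add_distrib]
  congr 1
  refine Finset.sum_congr rfl fun j _ => ?_
  linear_combination (-(k j * X i j) * ∑' m, hyperTerm X l (k - Pi.single j 1) n m) *
    mul_inv_cancel₀ hn

end Hypergeometric

/-! ### Sums over sequences of a given type as hypergeometric sums. -/

section TypeSum

variable {r n : ℕ}

/-- The sequences in which each `j` occurs exactly `k j` times. -/
def typeSet (n : ℕ) (k : Fin r → ℕ) : Finset (Fin n → Fin r) :=
  Finset.univ.filter fun a => ∀ j, (Finset.univ.filter fun i => a i = j).card = k j

theorem mem_typeSet {k : Fin r → ℕ} {a : Fin n → Fin r} :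
    a ∈ typeSet n k ↔ ∀ j, (Finset.univ.filter fun i => a i = j).card = k j := by
  simp [typeSet]

theorem card_filter_cons (j j' : Fin r) (a : Fin n → Fin r) :
    (Finset.univ.filter fun i => (Fin.cons j a : Fin (n + 1) → Fin r) i = j').card =
      (Finset.univ.filter fun i => a i = j').card + (Pi.single j 1 : Fin r → ℕ) j' := by
  rw [Fin.card_filter_univ_succ', add_comm]
  simp [Pi.single_apply, eq_comm]

theorem cons_mem_typeSet {k : Fin r → ℕ} {j : Fin r} {a : Fin n → Fin r} :
    (Fin.cons j a : Fin (n + 1) → Fin r) ∈ typeSet (n + 1) k ↔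
      k j ≠ 0 ∧ a ∈ typeSet n (k - Pi.single j 1) := by
  simp only [mem_typeSet, card_filter_cons]
  constructor
  · intro h
    refine ⟨fun h0 => by simpa [h0] using h j, fun j' => ?_⟩
    rw [Pi.sub_apply, ← h j', Nat.add_sub_cancel]
  · rintro ⟨h0, h⟩ j'
    rw [h j', Pi.sub_apply]
    by_cases hj : j' = j
    · subst hj
      rw [Pi.single_eq_same]
      omega
    · simp [hj]

theorem sum_typeSet_succ (x : Fin r → Fin r → ℂ) (i : Fin r) (b : Fin n → Fin r)
    (k : Fin r → ℕ) :
    ∑ a ∈ typeSet (n + 1) k, ∏ s, x ((Fin.cons i b : Fin (n + 1) → Fin r) s) (a s) =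
      ∑ j, if k j = 0 then 0 else
        x i j * ∑ a ∈ typeSet n (k - Pi.single j 1), ∏ s, x (b s) (a s) := by
  have h : ∀ (N : ℕ) (k : Fin r → ℕ) (F : (Fin N → Fin r) → ℂ),
      ∑ a ∈ typeSet N k, F a = ∑ a, if a ∈ typeSet N k then F a else 0 := fun N k F => by
    rw [Finset.sum_ite_mem, Finset.univ_inter]
  rw [h, ← Equiv.sum_comp (Fin.consEquiv fun _ => Fin r), Fintype.sum_prod_type]
  refine Finset.sum_congr rfl fun j _ => ?_
  rw [h, Finset.mul_sum]
  split_ifs with hj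
  · refine Finset.sum_eq_zero fun a _ => if_neg ?_
    simp [Fin.consEquiv, cons_mem_typeSet, hj]
  · refine Finset.sum_congr rfl fun a _ => ?_
    simp [Fin.consEquiv, cons_mem_typeSet, hj, Fin.prod_univ_succ]

theorem mul_prod_factorial_sub_single (k : Fin r → ℕ) (j : Fin r) (hj : k j ≠ 0) :
    ∏ x, ((k x).factorial : ℂ) =
      k j * ∏ x, (((k - Pi.single j 1 : Fin r → ℕ) x).factorial : ℂ) := by
  refine prod_eq_mul_prod_of_eq_off j _ ?_ fun x hx => by simp [hx]
  obtain ⟨t, ht⟩ := Nat.exists_eq_succ_of_ne_zero hj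
  simp [ht, Nat.factorial_succ]

theorem sum_eq_zero_add_sum_posIdx {M : Type*} [AddCommMonoid M] [NeZero r] (f : Fin r → M) :
    ∑ j, f j = f 0 + ∑ j : PosIdx r, f j.1 := by
  rw [← Finset.add_sum_erase _ _ (Finset.mem_univ (0 : Fin r))]
  congr 1
  refine Finset.sum_subtype _ (fun j => ?_) f
  rw [Finset.mem_erase, ne_eq, ← Fin.val_eq_zero_iff]
  simp

/-- Induction on `n`, splitting off the first letter of `b` and of `a`. The left side satisfies a
recursion over the first letter of `a`; the right side satisfies the same one, in its plain form if
the letter of `b` is `0` and with the factors `1 - X i j` otherwise. -/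
theorem sum_typeSet_mul_factorial [NeZero r] (x : Fin r → Fin r → ℂ) (hx₁ : ∀ j, x 0 j = 1)
    (hx₂ : ∀ i, x i 0 = 1) (b : Fin n → Fin r) (k : Fin r → ℕ) (hk : ∑ j, k j = n) :
    (∑ a ∈ typeSet n k, ∏ s, x (b s) (a s)) * ∏ j, ((k j).factorial : ℂ) =
      n.factorial * ∑' m, hyperTerm (fun i j : PosIdx r => 1 - x i.1 j.1)
        (fun i => (Finset.univ.filter fun s => b s = i.1).card) (fun j => k j.1) n m := by
  induction n generalizing k with
  | zero =>
    have hk0 : ∀ j, k j = 0 := fun j => by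
      have := Finset.single_le_sum (f := k) (fun _ _ => Nat.zero_le _) (Finset.mem_univ j)
      omega
    rw [tsum_eq_single 0]
    · simp [typeSet, hyperTerm, hk0]
    · intro m hm
      by_contra h
      apply hm
      have h0 := total_le_of_hyperTerm_ne_zero h
      funext i j
      have := (entry_le_total m i j).trans h0
      simpa using this
  | succ n ih =>
    obtain ⟨i, b, rfl⟩ : ∃ i b', b = Fin.cons i b' := ⟨b 0, Fin.tail b, (Fin.cons_self_tail b).symm⟩
    set X : PosIdx r → PosIdx r → ℂ := fun i j => 1 - x i.1 j.1 with hX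
    set l : PosIdx r → ℕ := fun i => (Finset.univ.filter fun s => b s = i.1).card with hl
    have hln : ∑ i, l i ≤ n := by
      have h1 : ∑ i : Fin r, (Finset.univ.filter fun s => b s = i).card =
          (Finset.univ.filter fun s => b s = 0).card + ∑ i, l i :=
        sum_eq_zero_add_sum_posIdx _
      have h2 : ∑ i : Fin r, (Finset.univ.filter fun s => b s = i).card = n := by
        rw [← Finset.card_eq_sum_card_fiberwise (fun _ _ => Finset.mem_univ _)]
        simp
      omega
    -- The hypergeometric side does not see `k 0`; it reappears as this coefficient, matching the
    -- term in which the removed letter of `a` is `0`.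
    have hk0 : ((n : ℂ) + 1 - ∑ j : PosIdx r, (k j.1 : ℂ)) = k 0 := by
      have h1 := sum_eq_zero_add_sum_posIdx k
      rw [hk] at h1
      have := congrArg (Nat.cast : ℕ → ℂ) h1
      push_cast at this
      rw [this]; ring
    have hres0 : (fun j : PosIdx r => (k - Pi.single 0 1 : Fin r → ℕ) j.1) = fun j => k j.1 := by
      funext j
      have : j.1 ≠ 0 := fun h => j.2 (by rw [h]; rfl)
      simp [this]
    have hresj : ∀ j : PosIdx r, (fun j' : PosIdx r => (k - Pi.single j.1 1 : Fin r → ℕ) j'.1) =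
        (fun j => k j.1) - Pi.single j 1 := by
      intro j
      funext j'
      simp [Pi.single_apply, Subtype.ext_iff]
    have hstep : (∑ a ∈ typeSet (n + 1) k,
        ∏ s, x ((Fin.cons i b : Fin (n + 1) → Fin r) s) (a s)) * ∏ j, ((k j).factorial : ℂ) =
        n.factorial * ∑ j, k j * (x i j * ∑' m, hyperTerm X l
          (fun j' => (k - Pi.single j 1 : Fin r → ℕ) j'.1) n m) := by
      rw [sum_typeSet_succ, Finset.sum_mul, Finset.mul_sum]
      refine Finset.sum_congr rfl fun j _ => ?_
      split_ifs with h
      · simp [h]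
      · have hkj : ∑ j', (k - Pi.single j 1 : Fin r → ℕ) j' = n := by
          have h1 : ∑ j', ((k - Pi.single j 1 : Fin r → ℕ) j' + (Pi.single j 1 : Fin r → ℕ) j') =
              n + 1 := by
            rw [← hk]
            refine Finset.sum_congr rfl fun j' _ => ?_
            by_cases hj : j' = j
            · subst hj; simp; omega
            · simp [hj]
          rw [Finset.sum_add_distrib] at h1
          simpa using h1
        rw [mul_prod_factorial_sub_single k j h]
        linear_combination (k j * x i j) * ih b (k - Pi.single j 1) hkj
    rw [hstep, sum_eq_zero_add_sum_posIdx, hx₂, one_mul, hres0, Nat.factorial_succ]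
    simp only [hresj]
    push_cast
    by_cases hi : i = 0
    · subst hi
      have hl' : (fun i : PosIdx r => (Finset.univ.filter fun s =>
          (Fin.cons 0 b : Fin (n + 1) → Fin r) s = i.1).card) = l := by
        funext i'
        have : i'.1 ≠ 0 := fun h => i'.2 (by rw [h]; rfl)
        rw [card_filter_cons]
        simp [this, hl]
      rw [hl', mul_comm ((n : ℂ) + 1), mul_assoc, succ_mul_tsum_hyperTerm X l _ n hln, hk0]
      simp only [hx₁, one_mul]
    · have hl' : (fun i' : PosIdx r => (Finset.univ.filter fun s =>
          (Fin.cons i b : Fin (n + 1) → Fin r) s = i'.1).card) =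
          l + Pi.single ⟨i, fun h => hi (Fin.ext h)⟩ 1 := by
        funext i'
        rw [card_filter_cons]
        simp [hl, Pi.single_apply, Subtype.ext_iff]
      rw [hl', mul_comm ((n : ℂ) + 1), mul_assoc,
        succ_mul_tsum_hyperTerm_add_single X l _ n hln, hk0]
      simp only [hX, sub_sub_cancel]

end TypeSum

/-! ### Identification of `omegaK` with a normalised monomial symmetric function. -/

section OmegaK

variable {r n : ℕ}

theorem xi_isPrimitiveRoot [NeZero r] : IsPrimitiveRoot (xi r) r :=
  Complex.isPrimitiveRoot_exp r (NeZero.ne r)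

theorem exists_pow_xi_eq [NeZero r] (ζ : rootsOfUnity r ℂ) :
    ∃ j : Fin r, ((ζ : ℂˣ) : ℂ) = xi r ^ (j : ℕ) := by
  have h : ((ζ : ℂˣ) : ℂ) ^ r = 1 := by
    rw [← Units.val_pow_eq_pow_val, (mem_rootsOfUnity r _).1 ζ.2, Units.val_one]
  obtain ⟨i, hi, h⟩ := xi_isPrimitiveRoot.eq_pow_of_pow_eq_one h
  exact ⟨⟨i, hi⟩, h.symm⟩

theorem pow_xi_injective [NeZero r] {i j : Fin r} (h : xi r ^ (i : ℕ) = xi r ^ (j : ℕ)) : i = j :=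
  Fin.ext (xi_isPrimitiveRoot.pow_inj i.2 j.2 h)

/-- The normalised monomial symmetric function of type `k`. -/
def typeAverage (k : Fin r → ℕ) (ζ : Fin n → rootsOfUnity r ℂ) : ℂ :=
  ((typeSet n k).card : ℂ)⁻¹ * ∑ a ∈ typeSet n k, ∏ i, (((ζ i : ℂˣ) : ℂ)) ^ (a i : ℕ)

/-- The multinomial formula is the case where all `x i j` are `1`: then `X` vanishes and only the
zero matrix contributes. -/
theorem card_typeSet_mul_factorial [NeZero r] (k : Comp r n) :
    ((typeSet n k.1).card : ℂ) * ∏ j, ((k.1 j).factorial : ℂ) = n.factorial := by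
  have h := sum_typeSet_mul_factorial (fun _ _ => 1) (fun _ => rfl) (fun _ => rfl)
    (fun _ : Fin n => 0) k.1 k.2
  rw [tsum_eq_single 0] at h
  · simpa [hyperTerm] using h
  · intro m hm
    obtain ⟨i, j, hij⟩ : ∃ i j, m i j ≠ 0 := by
      by_contra! h
      exact hm (funext fun i => funext fun j => h i j)
    have h0 : ∏ i, ∏ j, (-(1 - (1 : ℂ))) ^ m i j = 0 :=
      Finset.prod_eq_zero (Finset.mem_univ i)
        (Finset.prod_eq_zero (Finset.mem_univ j) (by simp [hij]))
    rw [hyperTerm, h0]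
    simp

theorem card_typeSet_ne_zero [NeZero r] (k : Comp r n) : ((typeSet n k.1).card : ℂ) ≠ 0 := by
  intro h
  have := card_typeSet_mul_factorial k
  rw [h, zero_mul] at this
  exact n.factorial_ne_zero (Nat.cast_eq_zero.1 this.symm)

theorem typeSet_nonempty [NeZero r] (k : Comp r n) : (typeSet n k.1).Nonempty := by
  rw [← Finset.card_ne_zero]
  exact fun h => card_typeSet_ne_zero k (by rw [h, Nat.cast_zero])

theorem omegaK_eq_typeAverage [NeZero r] (k : Comp r n) (g : GR r n) :
    omegaK k g = typeAverage k.1 g.left := by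
  choose b hb using fun i => exists_pow_xi_eq (g.left i)
  have hmult : ∀ j : Fin r, mult g j = (Finset.univ.filter fun s => b s = j).card := by
    intro j
    rw [mult, Nat.card_eq_fintype_card, Fintype.card_subtype]
    congr 1
    ext i
    simp only [Finset.mem_filter, Finset.mem_univ, true_and, hb]
    exact ⟨pow_xi_injective, fun h => by rw [h]⟩
  -- With `b` recording the exponents of `g`, the product of the `x (b s) (a s)` is the monomial
  -- with exponents `a` evaluated at the diagonal part of `g`.
  let x : Fin r → Fin r → ℂ := fun i j => xi r ^ ((i : ℕ) * (j : ℕ))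
  have h1 := sum_typeSet_mul_factorial x (fun j => by simp [x]) (fun j => by simp [x]) b k.1 k.2
  have h3 := card_typeSet_mul_factorial k
  have h4 : (∏ j, ((k.1 j).factorial : ℂ)) ≠ 0 := by
    intro h
    rw [h, mul_zero] at h3
    exact n.factorial_ne_zero (Nat.cast_eq_zero.1 h3.symm)
  rw [← h3] at h1
  have h6 : omegaK k g = ∑' m, hyperTerm (fun i j : PosIdx r => 1 - x i.1 j.1)
      (fun i => (Finset.univ.filter fun s => b s = i.1).card) (fun j => k.1 j.1) n m := by
    rw [← hyperF_neg_eq_tsum, omegaK]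
    simp only [hmult, x]
  rw [typeAverage, h6, eq_inv_mul_iff_mul_eq₀ (card_typeSet_ne_zero k)]
  apply mul_right_cancel₀ h4
  rw [mul_right_comm, ← h1]
  simp only [hb, x, pow_mul]

end OmegaK

/-! ### The characters of `C_r^n` and their orthogonality. -/

section Characters

variable {r n : ℕ}

/-- The character `ζ ↦ ∏ ζᵢ ^ aᵢ` of `C_r^n`. -/
def chi (a : Fin n → Fin r) : (Fin n → rootsOfUnity r ℂ) →* ℂˣ where
  toFun ζ := ∏ i, (ζ i : ℂˣ) ^ (a i : ℕ)
  map_one' := by simp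
  map_mul' ζ η := by simp [mul_pow, Finset.prod_mul_distrib]

theorem chi_apply (a : Fin n → Fin r) (ζ : Fin n → rootsOfUnity r ℂ) :
    chi a ζ = ∏ i, (ζ i : ℂˣ) ^ (a i : ℕ) := rfl

theorem coe_chi_apply (a : Fin n → Fin r) (ζ : Fin n → rootsOfUnity r ℂ) :
    (chi a ζ : ℂ) = ∏ i, ((ζ i : ℂˣ) : ℂ) ^ (a i : ℕ) := by
  simp [chi_apply]

theorem typeAverage_eq (k : Fin r → ℕ) (ζ : Fin n → rootsOfUnity r ℂ) :
    typeAverage k ζ = ((typeSet n k).card : ℂ)⁻¹ * ∑ a ∈ typeSet n k, (chi a ζ : ℂ) := by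
  simp only [typeAverage, coe_chi_apply]

theorem chi_comp_perm (a : Fin n → Fin r) (ζ : Fin n → rootsOfUnity r ℂ)
    (σ τ : Equiv.Perm (Fin n)) :
    chi (a ∘ τ) (ζ ∘ σ) = chi a (ζ ∘ (σ * τ⁻¹ : Equiv.Perm (Fin n))) := by
  rw [chi_apply, chi_apply,
    ← Equiv.prod_comp τ fun i =>
      ((ζ ∘ (σ * τ⁻¹ : Equiv.Perm (Fin n))) i : ℂˣ) ^ (a i : ℕ)]
  simp

theorem star_chi [NeZero r] (a : Fin n → Fin r) (ζ : Fin n → rootsOfUnity r ℂ) :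
    star (chi a ζ : ℂ) = ((chi a ζ)⁻¹ : ℂˣ) := by
  have h : (chi a ζ : ℂ) ^ r = 1 := by
    rw [coe_chi_apply, ← Finset.prod_pow]
    refine Finset.prod_eq_one fun i _ => ?_
    rw [pow_right_comm, ← Units.val_pow_eq_pow_val (ζ i : ℂˣ),
      (mem_rootsOfUnity r _).1 (ζ i).2, Units.val_one, one_pow]
  have h1 := Complex.norm_eq_one_of_pow_eq_one h (NeZero.ne r)
  rw [Units.val_inv_eq_inv_val]
  exact (Complex.inv_eq_conj h1).symm

/-- Orthogonality is stated along a homomorphism `κ` so that it covers both `C_r^n` and its subgroup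
`diagKer`, where distinct sequences may give the same character. -/
theorem sum_chi_mul_inv_chi {K : Type*} [Group K] [Fintype K]
    (κ : K →* (Fin n → rootsOfUnity r ℂ)) (a b : Fin n → Fin r)
    [Decidable (∀ x, chi a (κ x) = chi b (κ x))] :
    ∑ x, (chi a (κ x) : ℂ) * ((chi b (κ x))⁻¹ : ℂˣ) =
      if ∀ x, chi a (κ x) = chi b (κ x) then (Fintype.card K : ℂ) else 0 := by
  classical
  have h := sum_hom_units ((Units.coeHom ℂ).comp (((chi a) * (chi b)⁻¹).comp κ))
  have h2 : (Units.coeHom ℂ).comp (((chi a) * (chi b)⁻¹).comp κ) = 1 ↔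
      ∀ x, chi a (κ x) = chi b (κ x) := by
    rw [MonoidHom.ext_iff]
    refine forall_congr' fun x => ?_
    simp only [MonoidHom.comp_apply, MonoidHom.mul_apply, MonoidHom.inv_apply, MonoidHom.one_apply,
      Units.coeHom_apply, Units.val_eq_one]
    exact mul_inv_eq_one
  simp only [h2, Nat.cast_ite, Nat.cast_zero] at h
  rw [← h]
  exact Finset.sum_congr rfl fun x _ => by simp

/-- The generator of `C_r`. -/
def xiRoot (r : ℕ) [NeZero r] : rootsOfUnity r ℂ := xi_isPrimitiveRoot.toRootsOfUnity

theorem coe_xiRoot [NeZero r] : (((xiRoot r : rootsOfUnity r ℂ) : ℂˣ) : ℂ) = xi r := rfl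

theorem pow_xiRoot_injective [NeZero r] {i j : Fin r}
    (h : (xiRoot r : ℂˣ) ^ (i : ℕ) = (xiRoot r : ℂˣ) ^ (j : ℕ)) : i = j :=
  pow_xi_injective (by simpa [coe_xiRoot] using congrArg (Units.val) h)

theorem chi_mulSingle (a : Fin n → Fin r) (i : Fin n) (ζ : rootsOfUnity r ℂ) :
    chi a (Pi.mulSingle i ζ) = (ζ : ℂˣ) ^ (a i : ℕ) := by
  rw [chi_apply, Finset.prod_eq_single i]
  · rw [Pi.mulSingle_eq_same]
  · intro j _ hj
    rw [Pi.mulSingle_eq_of_ne hj]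
    simp
  · simp

theorem chi_injective [NeZero r] {a b : Fin n → Fin r} (h : ∀ ζ, chi a ζ = chi b ζ) : a = b := by
  funext i
  have := h (Pi.mulSingle i (xiRoot r))
  rw [chi_mulSingle, chi_mulSingle] at this
  exact pow_xiRoot_injective this

theorem exists_perm_of_mem_typeSet {k : Fin r → ℕ} {a b : Fin n → Fin r} (ha : a ∈ typeSet n k)
    (hb : b ∈ typeSet n k) : ∃ σ : Equiv.Perm (Fin n), b = a ∘ σ := by
  have h : ∀ j, Nonempty ({i // b i = j} ≃ {i // a i = j}) := fun j => by
    rw [← Fintype.card_eq, Fintype.card_subtype, Fintype.card_subtype, mem_typeSet.1 ha,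
      mem_typeSet.1 hb]
  refine ⟨Equiv.ofFiberEquiv fun j => (h j).some, funext fun i => ?_⟩
  exact (Equiv.ofFiberEquiv_map _ i).symm

theorem comp_mem_typeSet {k : Fin r → ℕ} {a : Fin n → Fin r} (σ : Equiv.Perm (Fin n)) :
    a ∘ σ ∈ typeSet n k ↔ a ∈ typeSet n k := by
  rw [mem_typeSet, mem_typeSet]
  refine forall_congr' fun j => ?_
  rw [Finset.card_equiv (t := Finset.univ.filter fun i => a i = j) σ (by simp)]

theorem sum_typeSet_comp {M : Type*} [AddCommMonoid M] (k : Fin r → ℕ) (σ : Equiv.Perm (Fin n))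
    (F : (Fin n → Fin r) → M) : ∑ a ∈ typeSet n k, F (a ∘ σ) = ∑ a ∈ typeSet n k, F a :=
  Finset.sum_equiv (Equiv.arrowCongr σ.symm (Equiv.refl _))
    (fun a => by
      rw [← comp_mem_typeSet σ]
      rfl) fun a _ => rfl

/-- The average of a character over all permutations only depends on its type. -/
theorem sum_perm_chi [NeZero r] (k : Comp r n) {a : Fin n → Fin r} (ha : a ∈ typeSet n k.1)
    (ζ : Fin n → rootsOfUnity r ℂ) :
    ∑ σ : Equiv.Perm (Fin n), (chi a (ζ ∘ σ) : ℂ) =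
      Fintype.card (Equiv.Perm (Fin n)) * typeAverage k.1 ζ := by
  have h1 : ∀ b ∈ typeSet n k.1, ∑ σ : Equiv.Perm (Fin n), (chi b (ζ ∘ σ) : ℂ) =
      ∑ σ : Equiv.Perm (Fin n), (chi a (ζ ∘ σ) : ℂ) := fun b hb => by
    obtain ⟨τ, rfl⟩ := exists_perm_of_mem_typeSet ha hb
    simp only [chi_comp_perm]
    exact Equiv.sum_comp (Equiv.mulRight τ⁻¹) fun σ => (chi a (ζ ∘ σ) : ℂ)
  have h2 : ∀ σ : Equiv.Perm (Fin n), ∑ b ∈ typeSet n k.1, (chi b (ζ ∘ σ) : ℂ) =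
      ∑ b ∈ typeSet n k.1, (chi b ζ : ℂ) := fun σ => by
    rw [← sum_typeSet_comp k.1 σ]
    refine Finset.sum_congr rfl fun b _ => ?_
    rw [chi_comp_perm, mul_inv_cancel]
    rfl
  -- Double counting over pairs of a permutation and a sequence of type `k`.
  have h3 : ((typeSet n k.1).card : ℂ) * ∑ σ : Equiv.Perm (Fin n), (chi a (ζ ∘ σ) : ℂ) =
      Fintype.card (Equiv.Perm (Fin n)) * ∑ b ∈ typeSet n k.1, (chi b ζ : ℂ) := by
    rw [← nsmul_eq_mul, ← Finset.sum_const, ← Finset.sum_congr rfl h1, Finset.sum_comm,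
      Finset.sum_congr rfl fun σ _ => h2 σ, Finset.sum_const, Finset.card_univ, nsmul_eq_mul]
  rw [typeAverage_eq]
  apply mul_left_cancel₀ (card_typeSet_ne_zero k)
  rw [h3]
  linear_combination (-(Fintype.card (Equiv.Perm (Fin n)) : ℂ) *
    ∑ b ∈ typeSet n k.1, (chi b ζ : ℂ)) * mul_inv_cancel₀ (card_typeSet_ne_zero k)

end Characters

/-! ### The representations `V^k` and their spherical functions. -/

section Monomials

variable {r n : ℕ}

/-- The monomial `∏ xᵢ ^ aᵢ`. -/
def mono (a : Fin n → Fin r) : MvPolynomial (Fin n) ℂ := ∏ i, MvPolynomial.X i ^ (a i : ℕ)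

/-- The coefficient of the monomial `∏ xᵢ ^ aᵢ`. -/
def monoCoeff (a : Fin n → Fin r) : MvPolynomial (Fin n) ℂ →ₗ[ℂ] ℂ :=
  MvPolynomial.lcoeff ℂ (Finsupp.equivFunOnFinite.symm fun i => (a i : ℕ))

theorem monoCoeff_mono (a b : Fin n → Fin r) :
    monoCoeff a (mono b) = if b = a then 1 else 0 := by
  classical
  have h : mono b = MvPolynomial.monomial (Finsupp.equivFunOnFinite.symm fun i => (b i : ℕ)) 1 := by
    rw [MvPolynomial.monomial_eq, map_one, one_mul, Finsupp.prod_fintype _ _ (by simp)]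
    rfl
  change MvPolynomial.coeff _ _ = _
  rw [h, MvPolynomial.coeff_monomial]
  refine if_congr ?_ rfl rfl
  rw [EmbeddingLike.apply_eq_iff_eq]
  constructor
  · intro h
    funext i
    exact Fin.ext (congrFun h i)
  · rintro rfl; rfl

theorem polyRep_mono (g : GR r n) (a : Fin n → Fin r) :
    polyRep r n g (mono a) =
      (((chi (a ∘ g.right.symm) g.left)⁻¹ : ℂˣ) : ℂ) • mono (a ∘ g.right.symm) := by
  change polyAct g (mono a) = _
  rw [mono, mono, chi_apply,
    ← Equiv.prod_comp g.right fun i => (g.left i : ℂˣ) ^ ((a ∘ g.right.symm) i : ℕ),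
    ← Equiv.prod_comp g.right
    (fun i => (MvPolynomial.X i : MvPolynomial (Fin n) ℂ) ^ ((a ∘ g.right.symm) i : ℕ))]
  simp only [polyAct, mul_pow, Finset.prod_mul_distrib, MvPolynomial.smul_eq_C_mul,
    map_prod, map_pow, MvPolynomial.aeval_X, Function.comp_apply, Equiv.symm_apply_apply,
    ← Finset.prod_inv_distrib, ← inv_pow, Units.coe_prod, Units.val_pow_eq_pow_val]

theorem mono_mem_Vrep (k : Comp r n) {a : Fin n → Fin r} (ha : a ∈ typeSet n k.1) :
    mono a ∈ (Vrep k).toSubmodule :=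
  Submodule.subset_span ⟨a, mem_typeSet.1 ha, rfl⟩

theorem eq_sum_of_mem_Vrep {k : Comp r n} {f : MvPolynomial (Fin n) ℂ}
    (hf : f ∈ (Vrep k).toSubmodule) : f = ∑ a ∈ typeSet n k.1, monoCoeff a f • mono a := by
  change f ∈ Submodule.span ℂ (monomialsOf k) at hf
  induction hf using Submodule.span_induction with
  | mem f hf =>
    obtain ⟨b, hb, rfl⟩ := hf
    change mono b = ∑ a ∈ typeSet n k.1, monoCoeff a (mono b) • mono a
    simp only [monoCoeff_mono, ite_smul, one_smul, zero_smul]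
    rw [Finset.sum_ite_eq, if_pos (mem_typeSet.2 hb)]
  | zero => simp
  | add f g _ _ hf hg =>
    simp only [map_add, add_smul, Finset.sum_add_distrib]
    rw [← hf, ← hg]
  | smul c f _ hf =>
    simp only [map_smul, smul_assoc, ← Finset.smul_sum]
    rw [← hf]

theorem monoCoeff_polyRep {k : Comp r n} {f : MvPolynomial (Fin n) ℂ}
    (hf : f ∈ (Vrep k).toSubmodule) (g : GR r n) (a : Fin n → Fin r) :
    monoCoeff a (polyRep r n g f) =
      (((chi a g.left)⁻¹ : ℂˣ) : ℂ) * monoCoeff (a ∘ g.right) f := by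
  rw [eq_sum_of_mem_Vrep hf]
  simp only [map_sum, map_smul, smul_eq_mul, Finset.mul_sum]
  refine Finset.sum_congr rfl fun b _ => ?_
  rw [polyRep_mono, map_smul, monoCoeff_mono, monoCoeff_mono]
  have h : b ∘ g.right.symm = a ↔ b = a ∘ g.right := by
    constructor
    · rintro rfl; funext i; simp
    · rintro rfl; funext i; simp
  by_cases hb : b = a ∘ g.right
  · rw [if_pos (h.2 hb), if_pos hb, h.2 hb]
    simp [mul_comm]
  · rw [if_neg (mt h.1 hb), if_neg hb]
    simp

/-- The inner product on `V^k` for which the monomials are orthonormal. -/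
@[reducible]
def coreVrep (k : Comp r n) : InnerProductSpace.Core ℂ (Vrep k).toSubmodule where
  inner f g := ∑ a ∈ typeSet n k.1, star (monoCoeff a f.1) * monoCoeff a g.1
  conj_inner_symm f g := by
    simp only [map_sum, map_mul]
    refine Finset.sum_congr rfl fun a _ => ?_
    rw [mul_comm]
    simp
  re_inner_nonneg f := by
    rw [map_sum]
    refine Finset.sum_nonneg fun a _ => ?_
    change 0 ≤ ((starRingEnd ℂ) (monoCoeff a f.1) * monoCoeff a f.1).re
    rw [← Complex.normSq_eq_conj_mul_self, Complex.ofReal_re]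
    exact Complex.normSq_nonneg _
  add_left f g h := by
    simp [add_mul, Finset.sum_add_distrib]
  smul_left f g c := by
    simp [Finset.mul_sum, mul_assoc]
  definite f hf := by
    have h1 : ∑ a ∈ typeSet n k.1, Complex.normSq (monoCoeff a f.1) = 0 := by
      have h2 : ((∑ a ∈ typeSet n k.1, Complex.normSq (monoCoeff a f.1) : ℝ) : ℂ) = 0 := by
        rw [← hf, Complex.ofReal_sum]
        exact Finset.sum_congr rfl fun a _ => Complex.normSq_eq_conj_mul_self
      exact_mod_cast h2
    rw [Finset.sum_eq_zero_iff_of_nonneg fun _ _ => Complex.normSq_nonneg _] at h1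
    refine Subtype.ext ?_
    rw [eq_sum_of_mem_Vrep f.2]
    exact Finset.sum_eq_zero fun a ha => by
      rw [Complex.normSq_eq_zero.1 (h1 a ha), zero_smul]

theorem coreVrep_inner (k : Comp r n) (f g : (Vrep k).toSubmodule) :
    (coreVrep k).inner f g = ∑ a ∈ typeSet n k.1, star (monoCoeff a f.1) * monoCoeff a g.1 := rfl

theorem coreVrep_invariant [NeZero r] (k : Comp r n) (g : GR r n) (v w : (Vrep k).toSubmodule) :
    (coreVrep k).inner ((Vrep k).toRepresentation g v) ((Vrep k).toRepresentation g w) =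
      (coreVrep k).inner v w := by
  rw [coreVrep_inner, coreVrep_inner, ← sum_typeSet_comp k.1 g.right
    fun a => star (monoCoeff a v.1) * monoCoeff a w.1]
  refine Finset.sum_congr rfl fun a _ => ?_
  have h : ∀ v : (Vrep k).toSubmodule, monoCoeff a ((Vrep k).toRepresentation g v).1 =
      (((chi a g.left)⁻¹ : ℂˣ) : ℂ) * monoCoeff (a ∘ g.right) v.1 := fun v =>
    monoCoeff_polyRep v.2 g a
  rw [h, h, star_mul', ← star_chi, star_star, star_chi]
  linear_combination (star (monoCoeff (a ∘ g.right) v.1) * monoCoeff (a ∘ g.right) w.1) *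
    Units.mul_inv (chi a g.left)

/-- The normalised `S_n`-invariant vector of `V^k`. -/
def unitVec (k : Comp r n) : (Vrep k).toSubmodule :=
  ⟨((Real.sqrt (typeSet n k.1).card : ℝ) : ℂ)⁻¹ • ∑ a ∈ typeSet n k.1, mono a,
    Submodule.smul_mem _ _ (Submodule.sum_mem _ fun _ ha => mono_mem_Vrep k ha)⟩

theorem monoCoeff_unitVec (k : Comp r n) {a : Fin n → Fin r} (ha : a ∈ typeSet n k.1) :
    monoCoeff a (unitVec k).1 = ((Real.sqrt (typeSet n k.1).card : ℝ) : ℂ)⁻¹ := by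
  rw [unitVec, map_smul, map_sum]
  simp only [monoCoeff_mono]
  rw [Finset.sum_ite_eq', if_pos ha, smul_eq_mul, mul_one]

theorem sqrt_card_mul_self [NeZero r] (k : Comp r n) :
    ((Real.sqrt (typeSet n k.1).card : ℝ) : ℂ)⁻¹ * ((Real.sqrt (typeSet n k.1).card : ℝ) : ℂ)⁻¹ =
      ((typeSet n k.1).card : ℂ)⁻¹ := by
  rw [← mul_inv, ← Complex.ofReal_mul, Real.mul_self_sqrt (Nat.cast_nonneg _),
    Complex.ofReal_natCast]

/-- The form is conjugate linear in its first argument, so the inverse character by which `g` acts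
on coefficients is conjugated back to `chi a`. -/
theorem inner_unitVec [NeZero r] (k : Comp r n) (g : GR r n) :
    (coreVrep k).inner ((Vrep k).toRepresentation g (unitVec k)) (unitVec k) =
      typeAverage k.1 g.left := by
  rw [coreVrep_inner, typeAverage_eq, Finset.mul_sum]
  refine Finset.sum_congr rfl fun a ha => ?_
  have h : monoCoeff a ((Vrep k).toRepresentation g (unitVec k)).1 =
      (((chi a g.left)⁻¹ : ℂˣ) : ℂ) * monoCoeff (a ∘ g.right) (unitVec k).1 :=
    monoCoeff_polyRep (unitVec k).2 g a
  rw [h, monoCoeff_unitVec k ha, monoCoeff_unitVec k ((comp_mem_typeSet _).2 ha), star_mul',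
    ← star_chi, star_star, star_inv₀, Complex.star_def, Complex.conj_ofReal, mul_assoc,
    sqrt_card_mul_self, mul_comm]

theorem inner_unitVec_self [NeZero r] (k : Comp r n) :
    (coreVrep k).inner (unitVec k) (unitVec k) = 1 := by
  have h := inner_unitVec k 1
  rw [map_one, Module.End.one_apply, typeAverage_eq] at h
  rw [h]
  simp [card_typeSet_ne_zero k]

theorem unitVec_ne_zero [NeZero r] (k : Comp r n) : unitVec k ≠ 0 := by
  intro h
  have := inner_unitVec_self k
  rw [h, core_inner_zero_left] at this
  exact zero_ne_one this

theorem Vrep_ext {k : Comp r n} {v w : (Vrep k).toSubmodule}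
    (h : ∀ a ∈ typeSet n k.1, monoCoeff a v.1 = monoCoeff a w.1) : v = w := by
  apply Subtype.ext
  rw [eq_sum_of_mem_Vrep v.2, eq_sum_of_mem_Vrep w.2]
  exact Finset.sum_congr rfl fun a ha => by rw [h a ha]

theorem unitVec_fixed (k : Comp r n) (g : GR r n) (hg : g ∈ Sn r n) :
    (Vrep k).toRepresentation g (unitVec k) = unitVec k := by
  obtain ⟨σ, rfl⟩ := hg
  refine Vrep_ext fun a ha => ?_
  refine (monoCoeff_polyRep (unitVec k).2 _ a).trans ?_
  rw [monoCoeff_unitVec k ha]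
  simp [monoCoeff_unitVec k ((comp_mem_typeSet σ).2 ha)]

/-- Permutations act transitively on the monomials of type `k`, so an invariant vector has all
coefficients equal. -/
theorem eq_smul_unitVec [NeZero r] (k : Comp r n) (w : (Vrep k).toSubmodule)
    (hw : ∀ g ∈ Sn r n, (Vrep k).toRepresentation g w = w) : ∃ c : ℂ, w = c • unitVec k := by
  obtain ⟨a, ha⟩ := typeSet_nonempty k
  have hs : monoCoeff a (unitVec k).1 ≠ 0 := by
    rw [monoCoeff_unitVec k ha]
    intro h
    have := sqrt_card_mul_self k
    rw [h, zero_mul] at this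
    exact inv_ne_zero (card_typeSet_ne_zero k) this.symm
  refine ⟨monoCoeff a w.1 * (monoCoeff a (unitVec k).1)⁻¹, Vrep_ext fun b hb => ?_⟩
  obtain ⟨σ, rfl⟩ := exists_perm_of_mem_typeSet ha hb
  have h1 : monoCoeff (a ∘ σ) w.1 = monoCoeff a w.1 := by
    have h2 := hw (SemidirectProduct.inr σ) ⟨σ, rfl⟩
    have h3 := monoCoeff_polyRep w.2 (SemidirectProduct.inr σ) a
    rw [show polyRep r n (SemidirectProduct.inr σ) w.1 = w.1 from congrArg Subtype.val h2] at h3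
    simpa using h3.symm
  have h4 : monoCoeff (a ∘ σ) (unitVec k).1 = monoCoeff a (unitVec k).1 := by
    rw [monoCoeff_unitVec k ha, monoCoeff_unitVec k hb]
  rw [h1, Submodule.coe_smul, map_smul, h4, smul_eq_mul, mul_assoc, inv_mul_cancel₀ hs, mul_one]

theorem sum_chi_smul_polyRep [NeZero r] [Fintype (Fin n → rootsOfUnity r ℂ)]
    {k : Comp r n} {f : MvPolynomial (Fin n) ℂ}
    (hf : f ∈ (Vrep k).toSubmodule) {a : Fin n → Fin r} (ha : a ∈ typeSet n k.1) :
    ∑ ζ : Fin n → rootsOfUnity r ℂ, (chi a ζ : ℂ) • polyRep r n (SemidirectProduct.inl ζ) f =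
      ((Fintype.card (Fin n → rootsOfUnity r ℂ) : ℂ) * monoCoeff a f) • mono a := by
  classical
  have hmem : ∑ ζ : Fin n → rootsOfUnity r ℂ,
      (chi a ζ : ℂ) • polyRep r n (SemidirectProduct.inl ζ) f ∈ (Vrep k).toSubmodule :=
    Submodule.sum_mem _ fun ζ _ =>
      Submodule.smul_mem _ _ ((Vrep k).apply_mem_toSubmodule _ hf)
  rw [eq_sum_of_mem_Vrep hmem, Finset.sum_eq_single a]
  · congr 1
    rw [map_sum]
    simp only [map_smul, monoCoeff_polyRep hf, smul_eq_mul, SemidirectProduct.left_inl,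
      ← mul_assoc, Units.mul_inv, one_mul]
    simp
  · intro b _ hb
    rw [map_sum]
    simp only [map_smul, monoCoeff_polyRep hf, smul_eq_mul, SemidirectProduct.left_inl,
      SemidirectProduct.right_inl, ← mul_assoc]
    rw [← Finset.sum_mul]
    have := sum_chi_mul_inv_chi (MonoidHom.id (Fin n → rootsOfUnity r ℂ)) a b
    rw [if_neg fun h : ∀ x, chi a (MonoidHom.id _ x) = chi b (MonoidHom.id _ x) =>
      hb (chi_injective h).symm] at this
    simp only [MonoidHom.id_apply] at this
    rw [this, zero_mul, zero_smul]
  · exact fun h => absurd ha h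

/-- A nonzero vector of `U` has some nonzero coefficient. The projection `sum_chi_smul_polyRep` puts
that monomial into `U`, and permutations supply all the others. -/
theorem Vrep_isIrreducible [NeZero r] (k : Comp r n) :
    (Vrep k).toRepresentation.IsIrreducible := by
  have := Fintype.ofFinite (Fin n → rootsOfUnity r ℂ)
  have hne : (⊥ : Subrepresentation (Vrep k).toRepresentation) ≠ ⊤ := by
    intro h
    have : unitVec k ∈ (⊥ : Subrepresentation (Vrep k).toRepresentation).toSubmodule := by
      rw [h]; exact Submodule.mem_top
    exact unitVec_ne_zero k this
  refine { exists_pair_ne := ⟨_, _, hne⟩, eq_bot_or_eq_top := fun U => ?_ }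
  by_cases hU : U = ⊥
  · exact Or.inl hU
  right
  obtain ⟨w, hw, hw0⟩ : ∃ w ∈ U.toSubmodule, w ≠ 0 := by
    by_contra! h
    exact hU (Subrepresentation.toSubmodule_injective ((Submodule.eq_bot_iff _).2 h))
  obtain ⟨a, ha, haw⟩ : ∃ a ∈ typeSet n k.1, monoCoeff a w.1 ≠ 0 := by
    by_contra! h
    exact hw0 (Vrep_ext fun a ha => by rw [h a ha]; simp)
  have hc : (Fintype.card (Fin n → rootsOfUnity r ℂ) : ℂ) * monoCoeff a w.1 ≠ 0 :=
    mul_ne_zero (Nat.cast_ne_zero.2 Fintype.card_ne_zero) haw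
  have hmono : (⟨mono a, mono_mem_Vrep k ha⟩ : (Vrep k).toSubmodule) ∈ U.toSubmodule := by
    have h1 : ∑ ζ : Fin n → rootsOfUnity r ℂ,
        (chi a ζ : ℂ) • (Vrep k).toRepresentation (SemidirectProduct.inl ζ) w ∈ U.toSubmodule :=
      Submodule.sum_mem _ fun ζ _ => Submodule.smul_mem _ _ (U.apply_mem_toSubmodule _ hw)
    have h2 : ∑ ζ : Fin n → rootsOfUnity r ℂ,
        (chi a ζ : ℂ) • (Vrep k).toRepresentation (SemidirectProduct.inl ζ) w =
        ((Fintype.card (Fin n → rootsOfUnity r ℂ) : ℂ) * monoCoeff a w.1) •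
          ⟨mono a, mono_mem_Vrep k ha⟩ := Subtype.ext (by
      rw [Submodule.coe_sum]
      exact sum_chi_smul_polyRep w.2 ha)
    rw [h2] at h1
    exact (Submodule.smul_mem_iff _ hc).1 h1
  have hall : ∀ b (hb : b ∈ typeSet n k.1),
      (⟨mono b, mono_mem_Vrep k hb⟩ : (Vrep k).toSubmodule) ∈ U.toSubmodule := fun b hb => by
    obtain ⟨σ, rfl⟩ := exists_perm_of_mem_typeSet ha hb
    have h1 := U.apply_mem_toSubmodule (SemidirectProduct.inr σ⁻¹) hmono
    have h2 : (Vrep k).toRepresentation (SemidirectProduct.inr σ⁻¹)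
        ⟨mono a, mono_mem_Vrep k ha⟩ = ⟨mono (a ∘ σ), mono_mem_Vrep k hb⟩ := Subtype.ext (by
      refine (polyRep_mono _ a).trans ?_
      rw [SemidirectProduct.left_inr, map_one, inv_one, Units.val_one, one_smul]
      rfl)
    rwa [h2] at h1
  apply Subrepresentation.toSubmodule_injective
  refine eq_top_iff.2 fun v _ => ?_
  have hv : v = ∑ b ∈ (typeSet n k.1).attach,
      monoCoeff b.1 v.1 • (⟨mono b.1, mono_mem_Vrep k b.2⟩ : (Vrep k).toSubmodule) :=
    Subtype.ext (by
      rw [Submodule.coe_sum]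
      conv_lhs => rw [eq_sum_of_mem_Vrep v.2, ← Finset.sum_attach]
      rfl)
  rw [hv]
  exact Submodule.sum_mem _ fun b _ => Submodule.smul_mem _ _ (hall b.1 b.2)

instance [NeZero r] : Finite (GR r n) :=
  Finite.of_equiv _ SemidirectProduct.equivProd.symm

theorem omegaK_isZonalSphericalOf [NeZero r] (k : Comp r n) :
    IsZonalSphericalOf (Sn r n) (Vrep k).toRepresentation (omegaK k) := by
  have hirr := Vrep_isIrreducible k
  refine ⟨hirr, ?_, coreVrep k, coreVrep_invariant k, unitVec k, unitVec_fixed k,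
    inner_unitVec_self k, fun g => by rw [omegaK_eq_typeAverage, inner_unitVec]⟩
  obtain ⟨U, _, f, hf, u, hu, _⟩ := exists_irreducible_of_fixed (Sn r n) (Vrep k).toRepresentation
    (unitVec k) (unitVec_fixed k) (unitVec_ne_zero k) (eq_smul_unitVec k)
  have hsurj : Function.Surjective f := by
    refine (Representation.IsIrreducible.surjective_or_eq_zero f).resolve_right fun h => ?_
    rw [h] at hu
    exact unitVec_ne_zero k hu.symm
  exact ⟨U, ⟨(f.ofBijective ⟨hf, hsurj⟩).symm⟩⟩

end Monomials

/-! ### Spherical functions of `G(r,d,n)`. -/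

section Kernel

variable {r d n : ℕ}

/-- The diagonal part of `G(r,d,n)`. -/
def diagKer (r d n : ℕ) : Subgroup (Fin n → rootsOfUnity r ℂ) :=
  (GRD r d n).comap SemidirectProduct.inl

theorem mem_diagKer {ζ : Fin n → rootsOfUnity r ℂ} :
    ζ ∈ diagKer r d n ↔ (∏ i, (ζ i : ℂˣ)) ^ (r / d) = 1 := Iff.rfl

/-- The inclusion of the diagonal part in `G(r,d,n)`. -/
def diagHom (r d n : ℕ) : diagKer r d n →* GRD r d n :=
  (SemidirectProduct.inl.comp (diagKer r d n).subtype).codRestrict _ fun x => x.2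

theorem left_mem_diagKer (g : GRD r d n) : g.1.left ∈ diagKer r d n := g.2

theorem exists_mul_eq_GR (g : GR r n) :
    ∃ ζ : Fin n → rootsOfUnity r ℂ, ∃ h ∈ Sn r n, g = SemidirectProduct.inl ζ * h :=
  ⟨g.left, _, ⟨g.right, rfl⟩, (SemidirectProduct.inl_left_mul_inr_right g).symm⟩

theorem exists_mul_eq_GRD (g : GRD r d n) :
    ∃ ζ : diagKer r d n, ∃ h ∈ SnD r d n, g = diagHom r d n ζ * h :=
  ⟨⟨g.1.left, left_mem_diagKer g⟩,
    ⟨SemidirectProduct.inr g.1.right, Sn_le_GRD r d n ⟨_, rfl⟩⟩, ⟨g.1.right, rfl⟩,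
    Subtype.ext (SemidirectProduct.inl_left_mul_inr_right g.1).symm⟩

theorem comp_mem_diagKer {ζ : Fin n → rootsOfUnity r ℂ} (hζ : ζ ∈ diagKer r d n)
    (σ : Equiv.Perm (Fin n)) : ζ ∘ σ ∈ diagKer r d n := by
  rw [mem_diagKer] at hζ ⊢
  rw [← hζ, ← Equiv.prod_comp σ fun i => (ζ i : ℂˣ)]
  rfl

theorem isGelfandPair_Sn [NeZero r] : IsGelfandPair (Sn r n) :=
  isGelfandPair_of_commGroup (Sn r n) SemidirectProduct.inl exists_mul_eq_GR

theorem isGelfandPair_SnD [NeZero r] : IsGelfandPair (SnD r d n) :=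
  isGelfandPair_of_commGroup (SnD r d n) (diagHom r d n) exists_mul_eq_GRD

theorem inl_mul_inr_eq (ζ : Fin n → rootsOfUnity r ℂ) (σ : Equiv.Perm (Fin n)) :
    (SemidirectProduct.inl ζ * SemidirectProduct.inr σ : GR r n) =
      SemidirectProduct.inr σ * SemidirectProduct.inl (ζ ∘ σ) := by
  refine SemidirectProduct.ext ?_ (by simp)
  simp only [SemidirectProduct.mul_left, SemidirectProduct.left_inl, SemidirectProduct.right_inl,
    SemidirectProduct.left_inr, SemidirectProduct.right_inr, map_one, mul_one, one_mul]
  funext i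
  exact congrArg ζ (σ.apply_symm_apply i).symm

/-- The element of `G(r,d,n)` given by a permutation. -/
def permGRD (r d n : ℕ) (σ : Equiv.Perm (Fin n)) : GRD r d n :=
  ⟨SemidirectProduct.inr σ, Sn_le_GRD r d n ⟨_, rfl⟩⟩

theorem permGRD_mem (σ : Equiv.Perm (Fin n)) : permGRD r d n σ ∈ SnD r d n := ⟨σ, rfl⟩

theorem coe_SnD_eq (h : SnD r d n) : h.1.1 = SemidirectProduct.inr h.1.1.right := by
  obtain ⟨σ, hσ⟩ := h.2
  have : h.1.1 = SemidirectProduct.inr σ := hσ.symm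
  rw [this, SemidirectProduct.right_inr]

theorem right_bijective_SnD :
    Function.Bijective fun h : SnD r d n => (h.1.1.right : Equiv.Perm (Fin n)) := by
  constructor
  · intro h h' hh
    apply Subtype.ext
    apply Subtype.ext
    rw [coe_SnD_eq h, coe_SnD_eq h']
    exact congrArg _ hh
  · exact fun σ => ⟨⟨permGRD r d n σ, permGRD_mem σ⟩, rfl⟩

/-- Irreducibility of `V^k` over the smaller group is not needed: its `S_n`-fixed vectors still form
a line, so the subrepresentation they generate is irreducible and has the same coefficient. -/
theorem omegaK_isZonalSpherical [NeZero r] (k : Comp r n) :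
    IsZonalSpherical (SnD r d n) fun g => omegaK k g.1 := by
  let ρ : Representation ℂ (GRD r d n) (Vrep k).toSubmodule :=
    (Vrep k).toRepresentation.comp (GRD r d n).subtype
  have hρ : ∀ g v, ρ g v = (Vrep k).toRepresentation g.1 v := fun _ _ => rfl
  obtain ⟨U, hU, f, hf, u, hu, hufix⟩ := exists_irreducible_of_fixed (SnD r d n) ρ (unitVec k)
    (fun h hh => unitVec_fixed k h.1 hh) (unitVec_ne_zero k) fun w hw => eq_smul_unitVec k w
      fun g hg => hw ⟨g, Sn_le_GRD r d n hg⟩ hg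
  refine ⟨U, hU, ?_⟩
  have := isSphericalCoefficient_comap (SnD r d n) f hf (coreVrep k)
    (fun g => coreVrep_invariant k g.1) u hufix (by rw [hu, inner_unitVec_self])
  convert this using 2 with g
  rw [hu, hρ, inner_unitVec, omegaK_eq_typeAverage]

theorem sum_pow_of_mem_rootsOfUnity [NeZero r] (ζ : rootsOfUnity r ℂ) (hζ : ζ ≠ 1) :
    ∑ j : Fin r, ((ζ : ℂˣ) : ℂ) ^ (j : ℕ) = 0 := by
  have h1 : ((ζ : ℂˣ) : ℂ) ≠ 1 := fun h => hζ (Subtype.ext (Units.ext h))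
  have h2 : ((ζ : ℂˣ) : ℂ) ^ r = 1 := by
    rw [← Units.val_pow_eq_pow_val, (mem_rootsOfUnity r _).1 ζ.2, Units.val_one]
  rw [Fin.sum_univ_eq_sum_range (fun j => ((ζ : ℂˣ) : ℂ) ^ j) r, geom_sum_eq h1, h2, sub_self,
    zero_div]

theorem sum_chi_eq_zero [NeZero r] (ζ : Fin n → rootsOfUnity r ℂ) (hζ : ζ ≠ 1) :
    ∑ a : Fin n → Fin r, (chi a ζ : ℂ) = 0 := by
  obtain ⟨i, hi⟩ := Function.ne_iff.1 hζ
  simp only [coe_chi_apply]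
  rw [← Fintype.prod_sum fun (i : Fin n) (j : Fin r) => ((ζ i : ℂˣ) : ℂ) ^ (j : ℕ)]
  exact Finset.prod_eq_zero (Finset.mem_univ i) (sum_pow_of_mem_rootsOfUnity _ hi)

/-- Summing `chi a` over all `a` detects the identity, so the components `e a` of `v` add up to `r ^
n • v` and one of them is nonzero. No extension of characters from `diagKer` to `C_r^n` is required.
-/
theorem exists_eigenvector_diagKer [NeZero r] {V : Type*} [AddCommGroup V] [Module ℂ V]
    (ρ : Representation ℂ (GRD r d n) V) (v : V) (hv : v ≠ 0) :
    ∃ (a : Fin n → Fin r) (u : V), u ≠ 0 ∧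
      ∀ ζ, ρ (diagHom r d n ζ) u = (((chi a ζ.1)⁻¹ : ℂˣ) : ℂ) • u := by
  have := Fintype.ofFinite (diagKer r d n)
  classical
  let e : (Fin n → Fin r) → V := fun a =>
    ∑ ζ : diagKer r d n, (chi a ζ.1 : ℂ) • ρ (diagHom r d n ζ) v
  have hsum : ∑ a, e a = (r : ℂ) ^ n • v := by
    simp only [e]
    rw [Finset.sum_comm]
    simp only [← Finset.sum_smul]
    rw [Finset.sum_eq_single 1]
    · simp
    · intro ζ _ hζ
      rw [sum_chi_eq_zero ζ.1 fun h => hζ (Subtype.ext h), zero_smul]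
    · simp
  obtain ⟨a, ha⟩ : ∃ a, e a ≠ 0 := by
    by_contra! h
    rw [Finset.sum_eq_zero fun a _ => h a] at hsum
    exact smul_ne_zero (pow_ne_zero n (Nat.cast_ne_zero.2 (NeZero.ne r))) hv hsum.symm
  refine ⟨a, e a, ha, fun η => ?_⟩
  simp only [e]
  rw [map_sum, Finset.smul_sum]
  refine Fintype.sum_equiv (Equiv.mulLeft η) _ _ fun ζ => ?_
  rw [map_smul, ← Module.End.mul_apply, ← map_mul, ← map_mul, Equiv.coe_mulLeft, smul_smul,
    Subgroup.coe_mul, map_mul (chi a), ← Units.val_mul, inv_mul_cancel_left]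

/-- The type of a sequence. -/
def typeOf (a : Fin n → Fin r) : Comp r n :=
  ⟨fun j => (Finset.univ.filter fun i => a i = j).card, by
    rw [← Finset.card_eq_sum_card_fiberwise (fun _ _ => Finset.mem_univ _)]
    simp⟩

theorem mem_typeSet_iff {k : Comp r n} {a : Fin n → Fin r} :
    a ∈ typeSet n k.1 ↔ typeOf a = k := by
  rw [mem_typeSet]
  exact ⟨fun h => Subtype.ext (funext h), by rintro rfl; exact fun _ => rfl⟩

theorem exists_inner_eq_omegaK [NeZero r] {V : Type} [AddCommGroup V] [Module ℂ V]
    {ρ : Representation ℂ (GRD r d n) V} (hU : ρ.IsIrreducible) (B : InnerProductSpace.Core ℂ V)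
    (hB : ∀ g v w, B.inner (ρ g v) (ρ g w) = B.inner v w) (v : V)
    (hv : ∀ h ∈ SnD r d n, ρ h v = v) (hv1 : B.inner v v = 1) :
    ∃ k : Comp r n, ∀ g, B.inner (ρ g v) v = omegaK k g.1 := by
  have hv0 : v ≠ 0 := by
    rintro rfl
    rw [core_inner_zero_left] at hv1
    exact zero_ne_one hv1
  obtain ⟨a, u, hu, hchi⟩ := exists_eigenvector_diagKer ρ v hv0
  have := Fintype.ofFinite (SnD r d n)
  let c : SnD r d n → diagKer r d n → diagKer r d n := fun h ζ =>
    ⟨ζ.1 ∘ (h.1.1.right : Equiv.Perm (Fin n)), comp_mem_diagKer ζ.2 _⟩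
  have hc : ∀ h ζ, diagHom r d n ζ * h = h * diagHom r d n (c h ζ) := by
    intro h ζ
    apply Subtype.ext
    change SemidirectProduct.inl ζ.1 * h.1.1 = h.1.1 * SemidirectProduct.inl (c h ζ).1
    rw [coe_SnD_eq h]
    exact inl_mul_inr_eq ζ.1 _
  -- Conjugating the inverse character gives `chi a`, whose average over permutations depends only
  -- on the type of `a`.
  refine ⟨typeOf a, fun g => ?_⟩
  have hval := inner_apply_fixed_eq_average (SnD r d n) (diagHom r d n) exists_mul_eq_GRD c hc hU B
    hB v hv hv1 u hu (fun ζ => (((chi a ζ.1)⁻¹ : ℂˣ) : ℂ)) hchi ⟨g.1.left, left_mem_diagKer g⟩ 1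
    (map_one _)
  have hg : g = diagHom r d n ⟨g.1.left, left_mem_diagKer g⟩ * permGRD r d n g.1.right :=
    Subtype.ext (SemidirectProduct.inl_left_mul_inr_right g.1).symm
  have hgv : ρ g v =
      ρ (diagHom r d n ⟨g.1.left, left_mem_diagKer g⟩) v :=
    (congrArg (fun x => ρ x v) hg).trans (by
      rw [map_mul, Module.End.mul_apply, hv _ (permGRD_mem g.1.right)])
  rw [hgv, hval, omegaK_eq_typeAverage]
  have hcard : Fintype.card (SnD r d n) = Fintype.card (Equiv.Perm (Fin n)) :=
    Fintype.card_of_bijective right_bijective_SnD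
  have hne : (Fintype.card (Equiv.Perm (Fin n)) : ℂ) ≠ 0 :=
    Nat.cast_ne_zero.2 Fintype.card_ne_zero
  rw [inv_mul_eq_iff_eq_mul₀ (by rw [hcard]; exact hne), hcard,
    ← sum_perm_chi (typeOf a) (mem_typeSet_iff.2 rfl) g.1.left]
  refine Fintype.sum_bijective _ right_bijective_SnD _ _ fun h => ?_
  rw [← star_chi, star_star]

theorem exists_eq_omegaK_of_isZonalSpherical [NeZero r] {Ω : GRD r d n → ℂ}
    (hΩ : IsZonalSpherical (SnD r d n) Ω) : ∃ k : Comp r n, ∀ g, Ω g = omegaK k g.1 := by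
  obtain ⟨U, hU, B, hB, v, hv, hv1, hform⟩ := hΩ
  obtain ⟨k, hk⟩ := exists_inner_eq_omegaK hU B hB v hv hv1
  exact ⟨k, fun g => (hform g).trans (hk g)⟩

end Kernel

/-! ### Equality of restrictions and orbits of `Γ`. -/

section Orbits

variable {r d n : ℕ}

theorem finRotate_pow_apply [NeZero r] (m : ℕ) (i : Fin r) :
    (((finRotate r ^ m) i : Fin r) : ℕ) = (i + m) % r := by
  obtain ⟨s, rfl⟩ := Nat.exists_eq_succ_of_ne_zero (NeZero.ne r)
  induction m with
  | zero => simp [Nat.mod_eq_of_lt i.2]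
  | succ m ih =>
    rw [pow_succ', Equiv.Perm.mul_apply, finRotate_apply, Fin.val_add, ih, Fin.val_one']
    simp only [Nat.add_mod_mod, Nat.mod_add_mod, add_assoc]

theorem pow_finRotate [NeZero r] (ζ : rootsOfUnity r ℂ) (m : ℕ) (i : Fin r) :
    (ζ : ℂˣ) ^ (((finRotate r ^ m) i : Fin r) : ℕ) = (ζ : ℂˣ) ^ (i : ℕ) * (ζ : ℂˣ) ^ m := by
  rw [finRotate_pow_apply, ← pow_add]
  have h := (mem_rootsOfUnity r _).1 ζ.2
  conv_rhs => rw [← Nat.mod_add_div (i + m) r, pow_add, pow_mul, h, one_pow, mul_one]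

/-- Exponents matter only modulo `r`, so rotating the letters adds `m` to each of them. The extra
factor is trivial on `diagKer` when `r / d` divides `m`. -/
theorem chi_finRotate [NeZero r] (a : Fin n → Fin r) (m : ℕ) (ζ : Fin n → rootsOfUnity r ℂ) :
    chi ((finRotate r ^ m) ∘ a) ζ = chi a ζ * (∏ i, (ζ i : ℂˣ)) ^ m := by
  simp only [chi_apply, Function.comp_apply, pow_finRotate, Finset.prod_mul_distrib,
    Finset.prod_pow]

theorem typeOf_perm_comp (π : Equiv.Perm (Fin r)) (a : Fin n → Fin r) :
    typeOf (π ∘ a) = π • typeOf a := by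
  refine Subtype.ext (funext fun j => ?_)
  change (Finset.univ.filter fun i => π (a i) = j).card =
    (Finset.univ.filter fun i => a i = π⁻¹ j).card
  simp only [Equiv.Perm.eq_inv_iff_eq]

theorem typeAverage_perm_smul [NeZero r] (π : Equiv.Perm (Fin r)) (k : Comp r n)
    (ζ : Fin n → rootsOfUnity r ℂ) (h : ∀ a, chi (π ∘ a) ζ = chi a ζ) :
    typeAverage (π • k).1 ζ = typeAverage k.1 ζ := by
  have hmem : ∀ a : Fin n → Fin r, a ∈ typeSet n k.1 ↔ π ∘ a ∈ typeSet n (π • k).1 := fun a => by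
    rw [mem_typeSet_iff, mem_typeSet_iff, typeOf_perm_comp, smul_left_cancel_iff]
  let e : (Fin n → Fin r) ≃ (Fin n → Fin r) := Equiv.arrowCongr (Equiv.refl _) π
  have he : ∀ a, e a = π ∘ a := fun _ => rfl
  rw [typeAverage_eq, typeAverage_eq, ← Finset.card_equiv e fun a => (he a).symm ▸ hmem a,
    ← Finset.sum_equiv e (fun a => (he a).symm ▸ hmem a) fun a _ => ?_]
  rw [he, h]

theorem exists_pow_of_mem_Gam [NeZero r] {γ : Equiv.Perm (Fin r)} (hγ : γ ∈ Gam r d) :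
    ∃ s : ℕ, γ = finRotate r ^ (r / d * s) := by
  obtain ⟨s, hs⟩ := mem_powers_iff_mem_zpowers.2 hγ
  exact ⟨s, by rw [pow_mul]; exact hs.symm⟩

theorem omegaK_Gam_smul [NeZero r] {γ : Equiv.Perm (Fin r)} (hγ : γ ∈ Gam r d) (k : Comp r n)
    (g : GRD r d n) : omegaK (γ • k) g.1 = omegaK k g.1 := by
  obtain ⟨s, rfl⟩ := exists_pow_of_mem_Gam hγ
  rw [omegaK_eq_typeAverage, omegaK_eq_typeAverage]
  refine typeAverage_perm_smul _ _ _ fun a => ?_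
  rw [chi_finRotate, pow_mul, mem_diagKer.1 (left_mem_diagKer g), one_pow, mul_one]

theorem exists_Gam_of_chi_eq [NeZero r] (hd : d ∣ r) {a b : Fin n → Fin r}
    (h : ∀ ζ ∈ diagKer r d n, chi a ζ = chi b ζ) : ∃ γ ∈ Gam r d, b = γ ∘ a := by
  rcases Nat.eq_zero_or_pos n with rfl | hn
  · exact ⟨1, one_mem _, Subsingleton.elim _ _⟩
  have hd0 : 0 < d := Nat.pos_of_dvd_of_pos hd (Nat.pos_of_ne_zero (NeZero.ne r))
  let i₀ : Fin n := ⟨0, hn⟩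
  set x : ℂˣ := (xiRoot r : ℂˣ) with hx
  have hxr : x ^ r = 1 := (mem_rootsOfUnity r _).1 (xiRoot r).2
  -- The difference of the letters at `i₀` modulo `r`, written without truncation.
  let c : ℕ := b i₀ + (r - a i₀)
  have hc : x ^ (b i₀ : ℕ) = x ^ (a i₀ : ℕ) * x ^ c := by
    rw [← pow_add, show (a i₀ : ℕ) + c = b i₀ + r by have := (a i₀).2; omega, pow_add, hxr, mul_one]
  have hprod : ∀ (i : Fin n) (ζ : rootsOfUnity r ℂ),
      ∏ j, ((Pi.mulSingle i ζ : Fin n → rootsOfUnity r ℂ) j : ℂˣ) = ζ := fun i ζ => by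
    rw [Finset.prod_eq_single i]
    · rw [Pi.mulSingle_eq_same]
    · intro j _ hj
      rw [Pi.mulSingle_eq_of_ne hj]
      rfl
    · simp
  have hpc : r / d ∣ c := by
    -- This test element lies in `diagKer` because `d * (r / d) = r`; it forces `r ∣ c * d`, hence
    -- `r / d ∣ c`.
    have h1 := h (Pi.mulSingle i₀ (xiRoot r ^ d)) (by
      rw [mem_diagKer, hprod, Subgroup.coe_pow, ← pow_mul, Nat.mul_div_cancel' hd]
      exact hxr)
    rw [chi_mulSingle, chi_mulSingle, Subgroup.coe_pow, pow_right_comm, pow_right_comm _ d,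
      ← hx, hc, mul_pow] at h1
    have h2 : x ^ (c * d) = 1 := by
      rw [pow_mul]; exact (mul_eq_left.1 h1.symm)
    have h3 : r ∣ c * d := by
      refine (xi_isPrimitiveRoot (r := r)).dvd_of_pow_eq_one _ ?_
      have := congrArg Units.val h2
      simpa [hx, coe_xiRoot] using this
    obtain ⟨p, hp⟩ := hd
    rw [hp, Nat.mul_div_cancel_left _ hd0]
    rw [hp, mul_comm c] at h3
    exact Nat.dvd_of_mul_dvd_mul_left hd0 h3
  obtain ⟨s, hs⟩ := hpc
  refine ⟨(finRotate r ^ (r / d)) ^ s, Subgroup.pow_mem _ (Subgroup.mem_zpowers _) s,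
    funext fun i => ?_⟩
  -- A test element with coordinate product `1`: it shows that `b` and `a` differ by the same
  -- residue at `i` as at `i₀`.
  have h1 := h (Pi.mulSingle i (xiRoot r) * (Pi.mulSingle i₀ (xiRoot r))⁻¹) (by
    rw [mem_diagKer]
    simp only [Pi.mul_apply, Pi.inv_apply, Subgroup.coe_mul, Subgroup.coe_inv,
      Finset.prod_mul_distrib, Finset.prod_inv_distrib, hprod, mul_inv_cancel, one_pow])
  rw [map_mul, map_mul, map_inv, map_inv, chi_mulSingle, chi_mulSingle, chi_mulSingle,
    chi_mulSingle, ← hx, hc] at h1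
  apply pow_xiRoot_injective
  rw [← pow_mul, ← hs, Function.comp_apply, pow_finRotate, ← hx]
  have h2 : x ^ (b i : ℕ) = (x ^ (a i : ℕ) * (x ^ (a i₀ : ℕ))⁻¹) * (x ^ (a i₀ : ℕ) * x ^ c) := by
    rw [h1, inv_mul_cancel_right]
  rw [h2, ← mul_assoc, inv_mul_cancel_right]

/-- Pairing with the character of a fixed `a` of type `k` over `diagKer` counts the sequences with
the same restricted character. The count is nonzero for `k`, hence for `k'`, so some `b` of type
`k'` restricts like `a` and is a `Γ`-translate of it. -/
theorem exists_Gam_smul_eq [NeZero r] (hd : d ∣ r) {k k' : Comp r n}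
    (h : ∀ g : GRD r d n, omegaK k g.1 = omegaK k' g.1) : ∃ γ ∈ Gam r d, k' = γ • k := by
  classical
  have := Fintype.ofFinite (diagKer r d n)
  have hav : ∀ ζ : diagKer r d n, typeAverage k.1 ζ.1 = typeAverage k'.1 ζ.1 := fun ζ => by
    have := h (diagHom r d n ζ)
    rwa [omegaK_eq_typeAverage, omegaK_eq_typeAverage] at this
  obtain ⟨a, ha⟩ := typeSet_nonempty k
  have hsum : ∀ k : Comp r n, ∑ ζ : diagKer r d n,
      typeAverage k.1 ζ.1 * (((chi a ζ.1)⁻¹ : ℂˣ) : ℂ) =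
      ((typeSet n k.1).card : ℂ)⁻¹ * ((Fintype.card (diagKer r d n) : ℂ) *
        ((typeSet n k.1).filter fun b => ∀ ζ : diagKer r d n, chi b ζ.1 = chi a ζ.1).card) := by
    intro k
    simp only [typeAverage_eq, mul_assoc, Finset.sum_mul]
    rw [← Finset.mul_sum, Finset.sum_comm]
    congr 1
    have this : ∀ b : Fin n → Fin r, ∑ ζ : diagKer r d n,
        (chi b ζ.1 : ℂ) * (((chi a ζ.1)⁻¹ : ℂˣ) : ℂ) =
        if ∀ ζ : diagKer r d n, chi b ζ.1 = chi a ζ.1 then (Fintype.card (diagKer r d n) : ℂ)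
          else 0 := fun b => sum_chi_mul_inv_chi (diagKer r d n).subtype b a
    rw [Finset.sum_congr rfl fun b _ => this b, Finset.card_filter, Nat.cast_sum, Finset.mul_sum]
    refine Finset.sum_congr rfl fun b _ => ?_
    by_cases hb : ∀ ζ : diagKer r d n, chi b ζ.1 = chi a ζ.1
    · rw [if_pos hb, if_pos hb, Nat.cast_one, mul_one]
    · rw [if_neg hb, if_neg hb, Nat.cast_zero, mul_zero]
  have h1 := hsum k
  have h2 := hsum k'
  simp only [hav] at h1
  rw [h2] at h1
  obtain ⟨b, hb⟩ : ((typeSet n k'.1).filter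
      fun b => ∀ ζ : diagKer r d n, chi b ζ.1 = chi a ζ.1).Nonempty := by
    rw [← Finset.card_ne_zero]
    intro h0
    rw [h0, Nat.cast_zero, mul_zero, mul_zero] at h1
    have h3 : ((typeSet n k.1).filter
        fun b => ∀ ζ : diagKer r d n, chi b ζ.1 = chi a ζ.1).card ≠ 0 :=
      Finset.card_ne_zero_of_mem (Finset.mem_filter.2 ⟨ha, fun _ => rfl⟩)
    exact mul_ne_zero (inv_ne_zero (card_typeSet_ne_zero k))
      (mul_ne_zero (Nat.cast_ne_zero.2 Fintype.card_ne_zero) (Nat.cast_ne_zero.2 h3)) h1.symm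
  rw [Finset.mem_filter] at hb
  obtain ⟨γ, hγ, rfl⟩ := exists_Gam_of_chi_eq hd fun ζ hζ => (hb.2 ⟨ζ, hζ⟩).symm
  refine ⟨γ, hγ, ?_⟩
  rw [← mem_typeSet_iff.1 hb.1, typeOf_perm_comp, mem_typeSet_iff.1 ha]

theorem orderOf_finRotate [NeZero r] : orderOf (finRotate r) = r := by
  rcases Nat.lt_or_ge r 2 with h | h
  · obtain rfl : r = 1 := by have := NeZero.ne r; omega
    rw [orderOf_eq_one_iff]
    exact Subsingleton.elim _ _
  · rw [(isCycle_finRotate_of_le h).orderOf, support_finRotate_of_le h]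
    simp

theorem nonempty_Gam_mulEquiv [NeZero r] (hd : d ∣ r) :
    Nonempty (Gam r d ≃* rootsOfUnity d ℂ) := by
  have : NeZero d := ⟨by rintro rfl; exact NeZero.ne r (Nat.eq_zero_of_zero_dvd hd)⟩
  have : IsCyclic (Gam r d) := Subgroup.isCyclic_zpowers _
  refine ⟨mulEquivOfCyclicCardEq ?_⟩
  rw [Complex.card_rootsOfUnity, Gam, Nat.card_zpowers, orderOf_pow, orderOf_finRotate,
    Nat.gcd_eq_right (Nat.div_dvd_of_dvd hd), Nat.div_div_self hd (NeZero.ne r)]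

end Orbits
end SphericalCRG

end

/-! ### The main theorem. -/

open SphericalCRG in
theorem mainTheorem1 (r d n : ℕ) (hr : 0 < r) (hd : d ∣ r) :
    -- both pairs are Gelfand pairs
    IsGelfandPair (Sn r n) ∧ IsGelfandPair (SnD r d n) ∧
    -- `Γ` is isomorphic to the group of `d`-th roots of unity
    Nonempty (Gam r d ≃* rootsOfUnity d ℂ) ∧
    -- the hypergeometric function of index `k` is the zonal spherical function of
    -- `(G(r,1,n), S_n)` belonging to `V^k`
    (∀ k : Comp r n, IsZonalSphericalOf (Sn r n) (Vrep k).toRepresentation (omegaK k)) ∧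
    -- restriction to `G(r,d,n)` induces a bijection from the `Γ`-orbits of indices onto the set
    -- of zonal spherical functions of `(G(r,d,n), S_n)`
    ∃ Ψ : MulAction.orbitRel.Quotient (Gam r d) (Comp r n) ≃
        {Ω : GRD r d n → ℂ // IsZonalSpherical (SnD r d n) Ω},
      ∀ (k : Comp r n) (g : GRD r d n),
        (Ψ (Quotient.mk (MulAction.orbitRel (Gam r d) (Comp r n)) k)).1 g = omegaK k (g : GR r n) := by
  have : NeZero r := ⟨hr.ne'⟩
  refine ⟨isGelfandPair_Sn, isGelfandPair_SnD, nonempty_Gam_mulEquiv hd,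
    omegaK_isZonalSphericalOf, ?_⟩
  let F : MulAction.orbitRel.Quotient (Gam r d) (Comp r n) →
      {Ω : GRD r d n → ℂ // IsZonalSpherical (SnD r d n) Ω} :=
    Quotient.lift (fun k => ⟨fun g => omegaK k g.1, omegaK_isZonalSpherical k⟩) (by
      rintro k k' ⟨γ, rfl⟩
      exact Subtype.ext (funext fun g => omegaK_Gam_smul γ.2 k' g))
  refine ⟨Equiv.ofBijective F ⟨?_, ?_⟩, fun k g => rfl⟩
  · intro q q'
    induction q using Quotient.inductionOn with
    | _ k =>
      induction q' using Quotient.inductionOn with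
      | _ k' =>
        intro h
        obtain ⟨γ, hγ, hk⟩ :=
          -- The orbit relation asks for `k` as a translate of `k'`, so the equality of functions is
          -- used in reverse.
          exists_Gam_smul_eq hd fun g => congrFun (congrArg Subtype.val h).symm g
        exact Quotient.sound ⟨⟨γ, hγ⟩, hk.symm⟩
  · rintro ⟨Ω, hΩ⟩
    obtain ⟨k, hk⟩ := exists_eq_omegaK_of_isZonalSpherical hΩ
    exact ⟨Quotient.mk _ k, Subtype.ext (funext fun g => (hk g).symm)⟩
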